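/- **Setting.** $L_0$ is the pure second-order language with equality: its only terms are individual variables and relation variables of every arity $\ge 1$. A Henkin structure is $\mathcal M=(M,S_1[M],S_2[M],\dots)$ with $M\neq\emptyset$ and $\emptyset\ne S_i[M]\subseteq\mathcal P(M^i)$; relation quantifiers of arity $i$ range over $S_i[M]$. Concepts are the elements of $S_1[M]$. Write $|X|\le|Y|$ (resp. $|X|=|Y|$) if there is an injection (resp. bijection) $X\to Y$ whose graph belongs to $\mathcal M$, and likewise for sets of pairs. $X$ is infinite in $\mathcal M$ ($|X|\ge\omega$) if $|X|\le|Y|$ for some concept $Y\subsetneq X$; otherwise $X$ is (Dedekind) finite in $\mathcal M$ ($|X|<\omega$). Assume that $\mathcal M$ satisfies full comprehension (all arities, all $L_0$-formulas, object and relation parameters allowed) and has well-behaved cardinalities: 1. $|X|\le|Y|$ or $|Y|\le|X|$ for all concepts $X,Y$; 2. $|X\sqcup Y|=\max(|X|,|Y|)$ whenever $|X|,|Y|\ge\omega$; 3. $|X\times Y|=\max(|X|,|Y|)$ whenever $|X|,|Y|\ge\omega$; 4. for every parameter-free $L_0$-formula $\Phi(X)$, if some concept satisfies $\Phi$, then there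 is a concept $X$ satisfying $\Phi$ with $|X|\le|Y|$ for every concept $Y$ satisfying $\Phi$. Write $|X|\trianglelefteq|Y|$ if for some natural number $n$ (of the metatheory) and some $n$-element concept $Z$ we have $|X|\le|Z\times Y|$ in $\mathcal M$, and $|X|\vartriangleleft|Y|$ if $|X|\trianglelefteq|Y|$ and not $|Y|\trianglelefteq|X|$. Write $X\boxminus Y$ if $|X|=|Y|$ and $|M-X|=|M-Y|$ in $\mathcal M$. Let $E$ be an equivalence relation on the concepts of $\mathcal M$. It is $L_0$-definable if it is defined in $\mathcal M$ by an $L_0$-formula with free variables $X,Y$ only (no parameters), and permutation-invariant if $E(X,Y)\Leftrightarrow E(\pi(X),\pi(Y))$ for every permutation $\pi$ of $M$ whose graph is in $\mathcal M$. Put $[X]_\boxminus=\{Y: X\boxminus Y\}$ and $[X]_{E(\boxminus)}=\{Y: X\boxminus Y,\ E(X,Y)\}$. The slice $E(\boxminus)_X$ is - *trivial* if $[X]_{E(\boxminus)}=[X]_\boxminus$; - *separative* if for all $Y,Z\in[X]_\boxminus$, $E(Y,Z)$ implies $|Y\triangle Z|\vartriangleleft|X|$; - *complementative* if for all $Y,Z\in[X]_\boxminus$,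 $E(Y,Z)$ implies $|Y\triangle Z|\vartriangleleft|X|$ or $|M-(Y\triangle Z)|\vartriangleleft|X|$; - *properly separative* if separative and non-trivial; *properly complementative* if complementative, non-separative and non-trivial. **Theorem.** Let $\mathcal M$ and $E$ be as above. (a) If $E$ is $L_0$-definable or permutation-invariant, then for every concept $X$ the slice $E(\boxminus)_X$ is trivial, separative or complementative. (b) If moreover $|M|>2$, then $E(\boxminus)_X$ is exactly one of: trivial, properly separative, properly complementative. If also $|X|\trianglelefteq|M-X|$, then exactly one of the following holds: $E(\boxminus)_X$ is trivial; it is separative; it is complementative but not separative. (c) If $E$ is $L_0$-definable and $X$ is finite in $\mathcal M$, or if $E$ is permutation-invariant and $X$ is finite in the metatheory, then $[X]_{E(\boxminus)}$ is $[X]_\boxminus$, or $\{X\}$, or $\{X,M-X\}$. -/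

import Mathlib

universe u

/-- Formulas of the pure second-order language with equality. All terms are variables: the
individual variables `x_i`, and for each arity `n + 1` the relation variables `V^{n+1}_j`. -/
inductive L0Formula : Type
  /-- `x_i = x_j` -/
  | eq (i j : ℕ) : L0Formula
  /-- `V^{n+1}_j (x_{t 0}, …, x_{t n})` -/
  | app (n j : ℕ) (t : Fin (n + 1) → ℕ) : L0Formula
  | neg (φ : L0Formula) : L0Formula
  | imp (φ ψ : L0Formula) : L0Formula
  /-- `∀ x_i, φ` -/
  | all (i : ℕ) (φ : L0Formula) : L0Formula
  /-- `∀ V^{n+1}_j, φ` -/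
  | allRel (n j : ℕ) (φ : L0Formula) : L0Formula

namespace L0Formula

/-- The free individual variables of a formula. -/
def freeInd : L0Formula → Set ℕ
  | eq i j => {i, j}
  | app _ _ t => Set.range t
  | neg φ => φ.freeInd
  | imp φ ψ => φ.freeInd ∪ ψ.freeInd
  | all i φ => φ.freeInd \ {i}
  | allRel _ _ φ => φ.freeInd

/-- The free relation variables of a formula; `(n, j)` stands for `V^{n+1}_j`. -/
def freeRel : L0Formula → Set (ℕ × ℕ)
  | eq _ _ => ∅
  | app n j _ => {(n, j)}
  | neg φ => φ.freeRel
  | imp φ ψ => φ.freeRel ∪ ψ.freeRel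
  | all _ φ => φ.freeRel
  | allRel n j φ => φ.freeRel \ {(n, j)}

end L0Formula

/-- A (Henkin) second-order structure `(M, S_1[M], S_2[M], …)` with first-order domain `M`:
`rel n` is `S_{n+1}[M]`, a collection of subsets of `M^{n+1}`. As usual, the range of every sort
of quantifier is non-empty (which comprehension without relation parameters requires anyway). -/
structure SOStructure (M : Type u) where
  rel : (n : ℕ) → Set (Set (Fin (n + 1) → M))
  rel_nonempty : ∀ n, (rel n).Nonempty

namespace SOStructure

variable {M : Type u} (S : SOStructure M)

/-- Concepts are the unary relations of the structure. -/
abbrev Concept : Type u := ↥(S.rel 0)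

variable {S} in
/-- The set of objects falling under a concept. -/
def Concept.carrier (X : S.Concept) : Set M := {x | (fun _ : Fin 1 => x) ∈ X.1}

/-- An assignment of objects and relations of the structure to the variables. -/
structure Assignment where
  ind : ℕ → M
  rel : (n : ℕ) → ℕ → ↥(S.rel n)

/-- Henkin satisfaction: relation quantifiers range over the relations of the structure. -/
def Sat (σ : S.Assignment) : L0Formula → Prop
  | .eq i j => σ.ind i = σ.ind j
  | .app n j t => (fun k => σ.ind (t k)) ∈ (σ.rel n j).1
  | .neg φ => ¬ Sat σ φ
  | .imp φ ψ => Sat σ φ → Sat σ ψ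
  | .all i φ => ∀ a : M, Sat ⟨Function.update σ.ind i a, σ.rel⟩ φ
  | .allRel n j φ => ∀ R : ↥(S.rel n),
      Sat ⟨σ.ind, Function.update σ.rel n (Function.update (σ.rel n) j R)⟩ φ

variable {S} in
/-- The assignment `σ` with `x_0, …, x_n` reassigned to the entries of `v`. -/
def Assignment.withTuple (σ : S.Assignment) {n : ℕ} (v : Fin (n + 1) → M) : S.Assignment :=
  ⟨fun i => if h : i < n + 1 then v ⟨i, h⟩ else σ.ind i, σ.rel⟩

/-- Full comprehension, for relations of every arity, with object and relation parameters
(the values of `σ` at the remaining variables). -/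
def Comprehension : Prop :=
  ∀ (φ : L0Formula) (σ : S.Assignment) (n : ℕ),
    {v : Fin (n + 1) → M | S.Sat (σ.withTuple v) φ} ∈ S.rel n

/-! ### Cardinality comparisons inside the structure -/

/-- `f` restricted to `X` is a function of the structure. -/
def HasFun (f : M → M) (X : Set M) : Prop :=
  {v : Fin 2 → M | v 0 ∈ X ∧ v 1 = f (v 0)} ∈ S.rel 1

/-- `|X| ≤ |Y|` in the structure. -/
def CardLE (X Y : Set M) : Prop :=
  ∃ f : M → M, S.HasFun f X ∧ Set.MapsTo f X Y ∧ Set.InjOn f X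

/-- `|X| = |Y|` in the structure. -/
def CardEq (X Y : Set M) : Prop :=
  ∃ f : M → M, S.HasFun f X ∧ Set.BijOn f X Y

/-- `|P| = |Y|` in the structure, for a set of pairs `P`. -/
def PairCardEq (P : Set (M × M)) (Y : Set M) : Prop :=
  ∃ f : M × M → M,
    {v : Fin 3 → M | (v 0, v 1) ∈ P ∧ v 2 = f (v 0, v 1)} ∈ S.rel 2 ∧ Set.BijOn f P Y

/-- `|X| ≤ |P|` in the structure, for a set of pairs `P`. -/
def CardLEPair (X : Set M) (P : Set (M × M)) : Prop :=
  ∃ f : M → M × M,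
    {v : Fin 3 → M | v 0 ∈ X ∧ (v 1, v 2) = f (v 0)} ∈ S.rel 2 ∧
      Set.MapsTo f X P ∧ Set.InjOn f X

/-- `|X| ≥ ω`: the structure has an injection of `X` into a proper subconcept of `X`. -/
def DedekindInfinite (X : Set M) : Prop :=
  ∃ Y : S.Concept, Y.carrier ⊂ X ∧ S.CardLE X Y.carrier

/-- `|X| < ω` in the structure. -/
def DedekindFinite (X : Set M) : Prop := ¬ S.DedekindInfinite X

/-! ### Well-behaved cardinalities -/

/-- Any two concepts are comparable in cardinality. -/
def CardinalComparability : Prop :=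
  ∀ X Y : S.Concept, S.CardLE X.carrier Y.carrier ∨ S.CardLE Y.carrier X.carrier

/-- `|P| = max (|X|, |Y|)` in the structure. -/
def PairCardEqMax (P : Set (M × M)) (X Y : Set M) : Prop :=
  (S.CardLE X Y → S.PairCardEq P Y) ∧ (S.CardLE Y X → S.PairCardEq P X)

/-- `|X ⊔ Y| = max (|X|, |Y|)` for infinite concepts, the disjoint union being coded by pairs
with two distinct tags `a`, `b`. -/
def InfiniteSumsAreMaxima : Prop :=
  ∀ X Y : S.Concept, S.DedekindInfinite X.carrier → S.DedekindInfinite Y.carrier →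
    ∀ a b : M, a ≠ b →
      S.PairCardEqMax ({a} ×ˢ X.carrier ∪ {b} ×ˢ Y.carrier) X.carrier Y.carrier

/-- `|X × Y| = max (|X|, |Y|)` for infinite concepts. -/
def InfiniteProductsAreMaxima : Prop :=
  ∀ X Y : S.Concept, S.DedekindInfinite X.carrier → S.DedekindInfinite Y.carrier →
    S.PairCardEqMax (X.carrier ×ˢ Y.carrier) X.carrier Y.carrier

/-- Well-foundedness of cardinality, as a scheme: if some concept satisfies the parameter-free
formula `Φ(V^1_0)`, then some concept satisfying it is of least cardinality among those that
do. -/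
def CardinalityWellFounded : Prop :=
  ∀ φ : L0Formula, φ.freeInd = ∅ → φ.freeRel ⊆ {(0, 0)} →
    (∃ σ : S.Assignment, S.Sat σ φ) →
      ∃ σ : S.Assignment, S.Sat σ φ ∧ ∀ τ : S.Assignment, S.Sat τ φ →
        S.CardLE (Concept.carrier (σ.rel 0 0)) (Concept.carrier (τ.rel 0 0))

/-- A structure with full comprehension and well-behaved cardinalities. -/
structure IsWellBehaved : Prop where
  comprehension : S.Comprehension
  cardinalComparability : S.CardinalComparability
  infiniteSums : S.InfiniteSumsAreMaxima
  infiniteProducts : S.InfiniteProductsAreMaxima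
  wellFounded : S.CardinalityWellFounded

/-! ### The relations `⊴` and `⊲` of the metatheory -/

/-- `n × |Y| ≥ |X|`: for some concept `Z` with exactly `n` elements, `|Z × Y| ≥ |X|` holds in
the structure. -/
def TimesGE (n : ℕ) (Y X : Set M) : Prop :=
  ∃ Z : S.Concept, Z.carrier.encard = n ∧ S.CardLEPair X (Z.carrier ×ˢ Y)

/-- `|X| ⊴ |Y|`: `n × |Y| ≥ |X|` for some natural number `n`. -/
def TriLE (X Y : Set M) : Prop := ∃ n : ℕ, S.TimesGE n Y X

/-- `|X| ⊲ |Y|`. -/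
def TriLT (X Y : Set M) : Prop := S.TriLE X Y ∧ ¬ S.TriLE Y X

/-! ### Equivalence relations on concepts and their bicardinal slices -/

/-- Bicardinal equivalence `X ⊟ Y`: `|X| = |Y|` and `|M - X| = |M - Y|` in the structure. -/
def Bicard (X Y : S.Concept) : Prop :=
  S.CardEq X.carrier Y.carrier ∧ S.CardEq (X.carrier)ᶜ (Y.carrier)ᶜ

/-- `E` is defined by a formula whose only free variables are `V^1_0` and `V^1_1`. -/
def L0Definable (E : S.Concept → S.Concept → Prop) : Prop :=
  ∃ φ : L0Formula, φ.freeInd = ∅ ∧ φ.freeRel ⊆ {(0, 0), (0, 1)} ∧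
    ∀ σ : S.Assignment, S.Sat σ φ ↔ E (σ.rel 0 0) (σ.rel 0 1)

/-- `E(X, Y) ↔ E(π(X), π(Y))` for every permutation `π` of `M` in the structure. -/
def PermInvariant (E : S.Concept → S.Concept → Prop) : Prop :=
  ∀ π : Equiv.Perm M, S.HasFun π Set.univ →
    ∀ X Y X' Y' : S.Concept, X'.carrier = π '' X.carrier → Y'.carrier = π '' Y.carrier →
      (E X Y ↔ E X' Y')

/-- The class `[X]_⊟`. -/
def bicardClass (X : S.Concept) : Set S.Concept := {Y | S.Bicard X Y}

/-- The class `[X]_{E(⊟)} = [X]_⊟ ∩ [X]_E`. -/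
def sliceClass (E : S.Concept → S.Concept → Prop) (X : S.Concept) : Set S.Concept :=
  {Y | S.Bicard X Y ∧ E X Y}

/-- The slice `E(⊟)_X` is trivial. -/
def Trivial (E : S.Concept → S.Concept → Prop) (X : S.Concept) : Prop :=
  S.sliceClass E X = S.bicardClass X

/-- The slice `E(⊟)_X` is separative. -/
def Separative (E : S.Concept → S.Concept → Prop) (X : S.Concept) : Prop :=
  ∀ Y ∈ S.bicardClass X, ∀ Z ∈ S.bicardClass X, E Y Z →
    S.TriLT (symmDiff Y.carrier Z.carrier) X.carrier

/-- The slice `E(⊟)_X` is complementative. -/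
def Complementative (E : S.Concept → S.Concept → Prop) (X : S.Concept) : Prop :=
  ∀ Y ∈ S.bicardClass X, ∀ Z ∈ S.bicardClass X, E Y Z →
    S.TriLT (symmDiff Y.carrier Z.carrier) X.carrier ∨
      S.TriLT (symmDiff Y.carrier Z.carrier)ᶜ X.carrier

/-- The slice `E(⊟)_X` is properly separative. -/
def ProperlySeparative (E : S.Concept → S.Concept → Prop) (X : S.Concept) : Prop :=
  S.Separative E X ∧ ¬ S.Trivial E X

/-- The slice `E(⊟)_X` is properly complementative. -/
def ProperlyComplementative (E : S.Concept → S.Concept → Prop) (X : S.Concept) : Prop :=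
  S.Complementative E X ∧ ¬ S.Separative E X ∧ ¬ S.Trivial E X

end SOStructure

/-- Exactly one of three propositions holds. -/
def ExactlyOneOfThree (P Q R : Prop) : Prop :=
  (P ∧ ¬ Q ∧ ¬ R) ∨ (¬ P ∧ Q ∧ ¬ R) ∨ (¬ P ∧ ¬ Q ∧ R)

/-! Permutations in the structure are automorphisms, so a definable `E` is permutation-invariant
(`L0Definable.permInvariant`). For an invariant `E`, gluing bijections shows that `E Y Z` depends
only on the internal cardinals of `Y ∩ Z`, `Y \ Z`, `Z \ Y` and `(Y ∪ Z)ᶜ`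
(`PermInvariant.iff_of_cardEq`). The relation `⊴` is handled as a covering relation `Cov`, which for
infinite `X` collapses to `|X| ≤ |Y|`.

Suppose the slice is not complementative: some related `Y`, `Z` in the class have both `Y △ Z` and
its complement large compared with `X`. Then a difference is large, and so is the intersection or
the outside of the union. Exchanging a piece of one large cell with a piece of the other fixes one
of `Y`, `Z` and alters the other, so by transitivity a concept is related to an altered copy of
itself. This forces triviality (`trivial_or_complementative`). If `X` is infinite, the altered pair
can be made "generic", all generic pairs have the same four cardinals, and any two members of the
class are both generic to a third concept (`rel_of_generic`). If `X` is finite, cancellation shows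
that all exchanges up to a certain size preserve `E`, and finitely many of them lead from any member
of the class to any other (`rel_of_small_swaps`).

For (c), a related concept other than `X` and its complement permits exchanges of single elements.
Finitely many suffice when `X` is finite in the metatheory. When `X` is only internally finite, the
induction must take place inside the structure, as a least counterexample from the well-foundedness
scheme; this is where definability of `E` is needed (`sliceClass_of_definable`).

The first trichotomy in (b) is then propositional. The second needs a trivial slice with `|X| ⊴ |M -
X|` not to be complementative: `exists_far` moves about half of `X` outside, using that finite
concepts can be halved (again by well-foundedness). -/

namespace SOStructure

variable {M : Type u} {S : SOStructure M}

/-! ### Closure of the relations of the structure under first-order operations -/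

/-- The predicate `P` on `(n + 1)`-tuples is a relation of the structure. -/
def IsRel (S : SOStructure M) {n : ℕ} (P : (Fin (n + 1) → M) → Prop) : Prop :=
  {v | P v} ∈ S.rel n

/-- The set `A` is (the extension of) a concept. -/
def IsC (S : SOStructure M) (A : Set M) : Prop :=
  S.IsRel (fun v : Fin 1 → M => v 0 ∈ A)

/-- An arbitrary assignment. -/
noncomputable def base [Nonempty M] (S : SOStructure M) : S.Assignment :=
  ⟨fun _ => Classical.arbitrary M, fun n _ => ⟨_, (S.rel_nonempty n).some_mem⟩⟩

/-- Comprehension in semantic form. The closure rules that follow apply it to very short formulas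
with the given relations as parameters, so that later definability proofs compose rules and write no
syntax. -/
theorem IsRel.of_sat (hc : S.Comprehension) {n : ℕ} {P : (Fin (n + 1) → M) → Prop}
    (φ : L0Formula) (σ : S.Assignment) (h : ∀ v, S.Sat (σ.withTuple v) φ ↔ P v) : S.IsRel P := by
  have := hc φ σ n
  simp only [h] at this
  exact this

@[simp] theorem Assignment.withTuple_ind (σ : S.Assignment) {n : ℕ} (v : Fin (n + 1) → M)
    (i : Fin (n + 1)) : (σ.withTuple v).ind i = v i := by
  simp only [withTuple, i.2, dite_true]

@[simp] theorem Assignment.withTuple_rel (σ : S.Assignment) {n : ℕ} (v : Fin (n + 1) → M) :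
    (σ.withTuple v).rel = σ.rel := rfl

theorem IsRel.congr {n : ℕ} {P Q : (Fin (n + 1) → M) → Prop} (hP : S.IsRel P)
    (h : ∀ v, P v ↔ Q v) : S.IsRel Q := by
  have : P = Q := funext fun v => propext (h v)
  exact this ▸ hP

section
variable [Nonempty M]

theorem IsRel.imp (hc : S.Comprehension) {n : ℕ} {P Q : (Fin (n + 1) → M) → Prop}
    (hP : S.IsRel P) (hQ : S.IsRel Q) : S.IsRel (fun v => P v → Q v) := by
  refine .of_sat hc (.imp (.app n 0 (fun k => k)) (.app n 1 (fun k => k)))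
    ⟨S.base.ind, Function.update S.base.rel n (fun j => if j = 0 then ⟨_, hP⟩ else ⟨_, hQ⟩)⟩ ?_
  intro v
  simp [Sat]

theorem IsRel.not (hc : S.Comprehension) {n : ℕ} {P : (Fin (n + 1) → M) → Prop}
    (hP : S.IsRel P) : S.IsRel (fun v => ¬ P v) := by
  refine .of_sat hc (.neg (.app n 0 (fun k => k)))
    ⟨S.base.ind, Function.update S.base.rel n (fun _ => ⟨_, hP⟩)⟩ ?_
  intro v
  simp [Sat]

theorem IsRel.all (hc : S.Comprehension) {n : ℕ} {P : (Fin (n + 1) → M) → M → Prop}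
    (hP : S.IsRel (fun w : Fin (n + 2) → M => P (Fin.init w) (w (Fin.last _)))) :
    S.IsRel (fun v => ∀ x, P v x) := by
  refine .of_sat hc (.all (n + 1) (.app (n + 1) 0 (fun k => k)))
    ⟨S.base.ind, Function.update S.base.rel (n + 1) (fun _ => ⟨_, hP⟩)⟩ ?_
  intro v
  simp only [Sat, Assignment.withTuple_rel, Function.update_self, Set.mem_ofPred_eq, Fin.val_last]
  refine forall_congr' fun a => ?_
  have h (σ : S.Assignment) : (Fin.init fun k : Fin (n + 2) => Function.update
      (σ.withTuple v).ind (n + 1) a k) = v := by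
    funext i
    simp [Fin.init, Function.update_of_ne i.2.ne]
  rw [h]

theorem IsRel.eq (hc : S.Comprehension) {n : ℕ} (i j : Fin (n + 1)) :
    S.IsRel (fun v => v i = v j) := by
  refine .of_sat hc (.eq i j) S.base ?_
  intro v
  simp [Sat]

theorem IsRel.eq_const (hc : S.Comprehension) {n : ℕ} (i : Fin (n + 1)) (a : M) :
    S.IsRel (fun v => v i = a) := by
  -- The variable `n + 1` is the first one outside the tuple, so it keeps the parameter value `a`.
  refine .of_sat hc (.eq i (n + 1)) ⟨fun _ => a, S.base.rel⟩ ?_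
  intro v
  have : ((⟨fun _ => a, S.base.rel⟩ : S.Assignment).withTuple v).ind (n + 1) = a := by
    simp [Assignment.withTuple]
  simp [Sat, this]

theorem IsRel.reindex (hc : S.Comprehension) {n m : ℕ} {P : (Fin (n + 1) → M) → Prop}
    (hP : S.IsRel P) (t : Fin (n + 1) → Fin (m + 1)) : S.IsRel (fun v => P (fun k => v (t k))) := by
  refine .of_sat hc (.app n 0 (fun k => t k))
    ⟨S.base.ind, Function.update S.base.rel n (fun _ => ⟨_, hP⟩)⟩ ?_
  intro v
  simp [Sat]

theorem IsRel.and (hc : S.Comprehension) {n : ℕ} {P Q : (Fin (n + 1) → M) → Prop}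
    (hP : S.IsRel P) (hQ : S.IsRel Q) : S.IsRel (fun v => P v ∧ Q v) :=
  (((hP.imp hc (hQ.not hc)).not hc)).congr fun v => by tauto

theorem IsRel.or (hc : S.Comprehension) {n : ℕ} {P Q : (Fin (n + 1) → M) → Prop}
    (hP : S.IsRel P) (hQ : S.IsRel Q) : S.IsRel (fun v => P v ∨ Q v) :=
  ((hP.not hc).imp hc hQ).congr fun v => by tauto

theorem IsRel.ex (hc : S.Comprehension) {n : ℕ} {P : (Fin (n + 1) → M) → M → Prop}
    (hP : S.IsRel (fun w : Fin (n + 2) → M => P (Fin.init w) (w (Fin.last _)))) :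
    S.IsRel (fun v => ∃ x, P v x) :=
  ((IsRel.all hc (P := fun v x => ¬ P v x) (hP.not hc)).not hc).congr fun v => by
    simp

theorem IsC.mem (hc : S.Comprehension) {A : Set M} (hA : S.IsC A) {n : ℕ} (i : Fin (n + 1)) :
    S.IsRel (fun v => v i ∈ A) :=
  IsRel.reindex hc hA (fun _ => i)

theorem HasFun.rel (hc : S.Comprehension) {f : M → M} {A : Set M} (hf : S.HasFun f A) {n : ℕ}
    (i j : Fin (n + 1)) : S.IsRel (fun v => v i ∈ A ∧ v j = f (v i)) :=
  IsRel.reindex (P := fun w : Fin 2 → M => w 0 ∈ A ∧ w 1 = f (w 0)) hc hf ![i, j]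

/-! ### Concepts -/

theorem IsC.compl (hc : S.Comprehension) {A : Set M} (hA : S.IsC A) : S.IsC Aᶜ :=
  IsRel.not hc hA

theorem IsC.union (hc : S.Comprehension) {A B : Set M} (hA : S.IsC A) (hB : S.IsC B) :
    S.IsC (A ∪ B) :=
  IsRel.or hc hA hB

theorem IsC.inter (hc : S.Comprehension) {A B : Set M} (hA : S.IsC A) (hB : S.IsC B) :
    S.IsC (A ∩ B) :=
  IsRel.and hc hA hB

theorem IsC.diff (hc : S.Comprehension) {A B : Set M} (hA : S.IsC A) (hB : S.IsC B) :
    S.IsC (A \ B) :=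
  IsRel.and hc hA (IsRel.not hc hB)

theorem IsC.symmDiff (hc : S.Comprehension) {A B : Set M} (hA : S.IsC A) (hB : S.IsC B) :
    S.IsC (symmDiff A B) :=
  (hA.diff hc hB).union hc (hB.diff hc hA)

theorem IsC.singleton (hc : S.Comprehension) (a : M) : S.IsC {a} :=
  IsRel.eq_const hc 0 a

theorem IsC.univ (hc : S.Comprehension) : S.IsC (Set.univ : Set M) :=
  (IsRel.eq hc (0 : Fin 1) 0).congr fun v => by simp

theorem IsC.empty (hc : S.Comprehension) : S.IsC (∅ : Set M) := by
  simpa using (IsC.univ hc).compl hc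

theorem IsC.of_finite (hc : S.Comprehension) {A : Set M} (hA : A.Finite) : S.IsC A := by
  induction A, hA using Set.Finite.induction_on with
  | empty => exact IsC.empty hc
  | insert _ _ ih => exact (IsC.singleton hc _).union hc ih

theorem HasFun.isC (hc : S.Comprehension) {f : M → M} {A : Set M} (hf : S.HasFun f A) :
    S.IsC A :=
  (IsRel.ex hc (P := fun (v : Fin 1 → M) y => v 0 ∈ A ∧ y = f (v 0)) (hf.rel hc 0 1)).congr
    fun v => by simp

end

theorem Concept.isC (X : S.Concept) : S.IsC X.carrier := by
  have h : X.1 = {v : Fin 1 → M | v 0 ∈ X.carrier} := by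
    ext v
    have : v = fun _ => v 0 := by
      funext i
      rw [Fin.fin_one_eq_zero i]
    rw [this]
    rfl
  have := X.2
  rw [h] at this
  exact this

theorem Concept.ext_carrier {X Y : S.Concept} (h : X.carrier = Y.carrier) : X = Y := by
  apply Subtype.ext
  ext v
  have : v = fun _ => v 0 := by
    funext i
    rw [Fin.fin_one_eq_zero i]
  rw [this]
  exact Set.ext_iff.1 h (v 0)

/-- The concept with a given extension. -/
def IsC.toConcept {A : Set M} (hA : S.IsC A) : S.Concept := ⟨{v | v 0 ∈ A}, hA⟩

@[simp] theorem IsC.carrier_toConcept {A : Set M} (hA : S.IsC A) : hA.toConcept.carrier = A := rfl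

/-! ### Functions of the structure -/

theorem CardEq.le {A B : Set M} (h : S.CardEq A B) : S.CardLE A B :=
  let ⟨f, hf, hb⟩ := h
  ⟨f, hf, hb.mapsTo, hb.injOn⟩

theorem CardEq.eq_empty {A : Set M} (h : S.CardEq A ∅) : A = ∅ := by
  obtain ⟨f, -, hb⟩ := h
  exact Set.eq_empty_of_forall_notMem fun x hx => hb.mapsTo hx

section
variable [Nonempty M]

theorem HasFun.mono (hc : S.Comprehension) {f : M → M} {A B : Set M} (hf : S.HasFun f B)
    (hA : S.IsC A) (h : A ⊆ B) : S.HasFun f A :=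
  ((hA.mem hc (0 : Fin 2)).and hc hf).congr fun v => by
    have := @h (v 0)
    tauto

theorem HasFun.id (hc : S.Comprehension) {A : Set M} (hA : S.IsC A) : S.HasFun id A :=
  (hA.mem hc (0 : Fin 2)).and hc (IsRel.eq hc 1 0)

theorem HasFun.const (hc : S.Comprehension) {A : Set M} (hA : S.IsC A) (b : M) :
    S.HasFun (fun _ => b) A :=
  (hA.mem hc (0 : Fin 2)).and hc (IsRel.eq_const hc 1 b)

theorem HasFun.comp (hc : S.Comprehension) {f g : M → M} {A B : Set M} (hg : S.HasFun g B)
    (hf : S.HasFun f A) (h : Set.MapsTo f A B) : S.HasFun (g ∘ f) A :=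
  (IsRel.ex hc (P := fun (v : Fin 2 → M) z => (v 0 ∈ A ∧ z = f (v 0)) ∧ (z ∈ B ∧ v 1 = g z))
    ((hf.rel hc 0 2).and hc (hg.rel hc 2 1))).congr fun v => by
      have := @h (v 0)
      simp only [Function.comp]
      grind

theorem HasFun.image (hc : S.Comprehension) {f : M → M} {A : Set M} (hf : S.HasFun f A) :
    S.IsC (f '' A) :=
  (IsRel.ex hc (P := fun (v : Fin 1 → M) x => x ∈ A ∧ v 0 = f x) (hf.rel hc 1 0)).congr
    fun v => by simp [eq_comm]

theorem HasFun.image' (hc : S.Comprehension) {f : M → M} {A B : Set M} (hf : S.HasFun f A)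
    (hB : S.IsC B) (h : B ⊆ A) : S.IsC (f '' B) :=
  (hf.mono hc hB h).image hc

theorem HasFun.invFunOn (hc : S.Comprehension) {f : M → M} {A : Set M} (hf : S.HasFun f A)
    (hi : Set.InjOn f A) : S.HasFun (Function.invFunOn f A) (f '' A) :=
  (hf.rel hc (n := 1) 1 0).congr fun v => by
    constructor
    · rintro ⟨h1, h2⟩
      refine ⟨⟨_, h1, h2.symm⟩, ?_⟩
      rw [h2, hi.leftInvOn_invFunOn h1]
    · rintro ⟨⟨x, hx, hxv⟩, h2⟩
      rw [← hxv, hi.leftInvOn_invFunOn hx] at h2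
      exact ⟨h2 ▸ hx, h2 ▸ hxv.symm⟩

open Classical in
theorem HasFun.piecewise (hc : S.Comprehension) {f g : M → M} {A B : Set M} (hf : S.HasFun f A)
    (hg : S.HasFun g B) : S.HasFun (A.piecewise f g) (A ∪ B) :=
  (IsRel.or hc (hf.rel hc (0 : Fin 2) 1)
    ((((hf.isC hc).mem hc 0).not hc).and hc (hg.rel hc 0 1))).congr fun v => by
      by_cases h : v 0 ∈ A <;> simp [h]

theorem HasFun.preimage (hc : S.Comprehension) {f : M → M} {A B : Set M} (hf : S.HasFun f A)
    (hB : S.IsC B) : S.IsC (A ∩ f ⁻¹' B) :=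
  (IsRel.ex hc (P := fun (v : Fin 1 → M) y => (v 0 ∈ A ∧ y = f (v 0)) ∧ y ∈ B)
    ((hf.rel hc 0 1).and hc (hB.mem hc 1))).congr fun v => by
      simp

/-! ### Equinumerosity -/

theorem CardEq.refl (hc : S.Comprehension) {A : Set M} (hA : S.IsC A) : S.CardEq A A :=
  ⟨_, .id hc hA, Set.bijOn_id A⟩

theorem CardLE.of_subset (hc : S.Comprehension) {A B : Set M} (hA : S.IsC A) (h : A ⊆ B) :
    S.CardLE A B :=
  ⟨_, .id hc hA, fun _ hx => h hx, Set.injOn_id A⟩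

theorem CardEq.symm (hc : S.Comprehension) {A B : Set M} (h : S.CardEq A B) : S.CardEq B A := by
  obtain ⟨f, hf, hb⟩ := h
  refine ⟨_, hb.image_eq ▸ hf.invFunOn hc hb.injOn, ?_⟩
  exact hb.invOn_invFunOn.symm.bijOn (hb.surjOn.mapsTo_invFunOn) hb.mapsTo

theorem CardEq.trans (hc : S.Comprehension) {A B C : Set M} (h : S.CardEq A B)
    (h' : S.CardEq B C) : S.CardEq A C := by
  obtain ⟨f, hf, hb⟩ := h
  obtain ⟨g, hg, hb'⟩ := h'
  exact ⟨g ∘ f, hg.comp hc hf hb.mapsTo, hb'.comp hb⟩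

theorem CardLE.trans (hc : S.Comprehension) {A B C : Set M} (h : S.CardLE A B)
    (h' : S.CardLE B C) : S.CardLE A C := by
  obtain ⟨f, hf, hm, hi⟩ := h
  obtain ⟨g, hg, hm', hi'⟩ := h'
  exact ⟨g ∘ f, hg.comp hc hf hm, hm'.comp hm, hi'.comp hi hm⟩

theorem CardLE.left_isC (hc : S.Comprehension) {A B : Set M} (h : S.CardLE A B) : S.IsC A :=
  let ⟨_, hf, _⟩ := h
  hf.isC hc

theorem CardEq.left_isC (hc : S.Comprehension) {A B : Set M} (h : S.CardEq A B) : S.IsC A :=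
  h.le.left_isC hc

theorem CardLE.exists_subset (hc : S.Comprehension) {A B : Set M} (h : S.CardLE A B) :
    ∃ C ⊆ B, S.IsC C ∧ S.CardEq A C := by
  obtain ⟨f, hf, hm, hi⟩ := h
  exact ⟨f '' A, hm.image_subset, hf.image hc, f, hf, hi.bijOn_image⟩

theorem CardEq.singleton (hc : S.Comprehension) (a b : M) : S.CardEq {a} {b} :=
  ⟨fun _ => b, .const hc (.singleton hc a) b, by simp [Set.bijOn_singleton]⟩

theorem CardLE.singleton (hc : S.Comprehension) (a : M) {B : Set M} (h : B.Nonempty) :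
    S.CardLE {a} B :=
  let ⟨b, hb⟩ := h
  ⟨fun _ => b, .const hc (.singleton hc a) b, fun _ _ => hb, Set.injOn_singleton _ _⟩

/-- Bijections of the structure between disjoint sets can be glued. -/
theorem exists_glue (hc : S.Comprehension) {f g : M → M} {A B A' B' : Set M}
    (hf : S.HasFun f A) (hg : S.HasFun g A') (hfb : Set.BijOn f A B) (hgb : Set.BijOn g A' B')
    (hd : Disjoint A A') (hd' : Disjoint B B') :
    ∃ h : M → M, S.HasFun h (A ∪ A') ∧ Set.BijOn h (A ∪ A') (B ∪ B') ∧ Set.EqOn h f A ∧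
      Set.EqOn h g A' := by
  classical
  have e1 : Set.EqOn (A.piecewise f g) f A := Set.piecewise_eqOn ..
  have e2 : Set.EqOn (A.piecewise f g) g A' :=
    (Set.piecewise_eqOn_compl A f g).mono hd.subset_compl_left
  refine ⟨A.piecewise f g, hf.piecewise hc hg, ?_, e1, e2⟩
  refine (hfb.congr e1.symm).union (hgb.congr e2.symm) ?_
  rw [Set.injOn_union hd]
  refine ⟨hfb.injOn.congr e1.symm, hgb.injOn.congr e2.symm, fun x hx y hy h => ?_⟩
  rw [e1 hx, e2 hy] at h
  exact Set.disjoint_left.1 hd' (hfb.mapsTo hx) (h ▸ hgb.mapsTo hy)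

theorem CardEq.union (hc : S.Comprehension) {A B A' B' : Set M} (h : S.CardEq A B)
    (h' : S.CardEq A' B') (hd : Disjoint A A') (hd' : Disjoint B B') :
    S.CardEq (A ∪ A') (B ∪ B') := by
  obtain ⟨f, hf, hb⟩ := h
  obtain ⟨g, hg, hb'⟩ := h'
  obtain ⟨k, hk, hkb, -⟩ := exists_glue hc hf hg hb hb' hd hd'
  exact ⟨k, hk, hkb⟩

theorem CardLE.union (hc : S.Comprehension) {A B A' B' : Set M} (h : S.CardLE A B)
    (h' : S.CardLE A' B') (hd' : Disjoint B B') : S.CardLE (A ∪ A') (B ∪ B') := by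
  obtain ⟨C, hCB, -, h1⟩ := h.exists_subset hc
  obtain ⟨C', hCB', hC', h2⟩ := ((CardLE.of_subset hc ((h'.left_isC hc).diff hc
    (h.left_isC hc)) Set.sdiff_subset).trans hc h').exists_subset hc
  obtain ⟨f, hf, hb⟩ := h1.union hc h2 Set.disjoint_sdiff_right
    (hd'.mono hCB hCB')
  rw [Set.union_sdiff_self] at hf hb
  exact ⟨f, hf, hb.mapsTo.mono_right (Set.union_subset_union hCB hCB'), hb.injOn⟩

end

end SOStructure

namespace SOStructure

variable {M : Type u} {S : SOStructure M}

/-! ### Dedekind finite and infinite concepts -/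

theorem IsWellBehaved.total (hS : S.IsWellBehaved) {A B : Set M} (hA : S.IsC A) (hB : S.IsC B) :
    S.CardLE A B ∨ S.CardLE B A :=
  hS.cardinalComparability hA.toConcept hB.toConcept

theorem DedekindInfinite.exists_ne {A : Set M} (h : S.DedekindInfinite A) :
    ∃ a b : M, a ≠ b := by
  obtain ⟨Y, hY, f, -, hm, -⟩ := h
  obtain ⟨a, ha, ha'⟩ := Set.exists_of_ssubset hY
  exact ⟨a, f a, fun e => ha' (e ▸ hm ha)⟩

theorem DedekindFinite.eq_of_subset {A B : Set M} (hA : S.DedekindFinite A) (hB : S.IsC B)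
    (h : B ⊆ A) (hle : S.CardLE A B) : B = A := by
  by_contra hne
  exact hA ⟨hB.toConcept, h.ssubset_of_ne hne, hle⟩

theorem DedekindFinite.of_finite {A : Set M} (hA : A.Finite) : S.DedekindFinite A := by
  rintro ⟨Y, hY, f, -, hm, hi⟩
  have h1 := Set.ncard_lt_ncard hY hA
  have h2 := Set.ncard_le_ncard_of_injOn f hm hi (hA.subset hY.subset)
  omega

section
variable [Nonempty M]

theorem HasFun.cardEq_image (hc : S.Comprehension) {f : M → M} {A B : Set M} (hf : S.HasFun f A)
    (hi : Set.InjOn f A) (hB : S.IsC B) (h : B ⊆ A) : S.CardEq B (f '' B) :=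
  ⟨f, hf.mono hc hB h, (hi.mono h).bijOn_image⟩

/-- The self-injection of `A` is transported to its copy in `B` and extended by the identity on the
rest of `B`. -/
theorem DedekindInfinite.mono (hc : S.Comprehension) {A B : Set M} (hA : S.DedekindInfinite A)
    (hB : S.IsC B) (h : S.CardLE A B) : S.DedekindInfinite B := by
  obtain ⟨f, hf, hm, hi⟩ := h
  obtain ⟨Y, hY, hle⟩ := hA
  have hAC := hf.isC hc
  have hYs := hf.image' hc Y.isC hY.subset
  have hle' : S.CardLE (f '' A) (f '' Y.carrier) :=
    (((hf.cardEq_image hc hi hAC subset_rfl).symm hc).le.trans hc hle).trans hc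
      (hf.cardEq_image hc hi Y.isC hY.subset).le
  have hD := hB.diff hc (hf.image hc)
  have hu := hle'.union hc (CardEq.refl hc hD).le
    (Set.disjoint_sdiff_right.mono_left (Set.image_mono hY.subset))
  rw [Set.union_sdiff_cancel hm.image_subset] at hu
  refine ⟨(hYs.union hc hD).toConcept, ?_, hu⟩
  obtain ⟨a, ha, ha'⟩ := Set.exists_of_ssubset hY
  refine (Set.ssubset_iff_of_subset ?_).2 ⟨f a, hm ha, ?_⟩
  · exact Set.union_subset ((Set.image_mono hY.subset).trans hm.image_subset) Set.sdiff_subset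
  · rintro (⟨y, hy, hya⟩ | h)
    · exact ha' (hi (hY.subset hy) ha hya ▸ hy)
    · exact h.2 ⟨a, ha, rfl⟩

theorem DedekindFinite.mono (hc : S.Comprehension) {A B : Set M} (hB : S.DedekindFinite B)
    (hBC : S.IsC B) (h : S.CardLE A B) : S.DedekindFinite A :=
  fun hA => hB (hA.mono hc hBC h)

theorem DedekindFinite.subset (hc : S.Comprehension) {A B : Set M} (hB : S.DedekindFinite B)
    (hBC : S.IsC B) (hA : S.IsC A) (h : A ⊆ B) : S.DedekindFinite A :=
  hB.mono hc hBC (.of_subset hc hA h)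

/-! ### Cardinal arithmetic of the structure -/

theorem PairCardEq.cardEq (hc : S.Comprehension) {P : Set (M × M)} {A B : Set M}
    (hA : S.PairCardEq P A) (hB : S.PairCardEq P B) : S.CardEq A B := by
  obtain ⟨f, hf, hfb⟩ := hA
  obtain ⟨g, hg, hgb⟩ := hB
  have hinv := hfb.invOn_invFunOn
  have hmaps := hfb.surjOn.mapsTo_invFunOn
  refine ⟨g ∘ Function.invFunOn f P, ?_, hgb.comp (hinv.symm.bijOn hmaps hfb.mapsTo)⟩
  have h1 := IsRel.reindex (P := fun v : Fin 3 → M => (v 0, v 1) ∈ P ∧ v 2 = f (v 0, v 1)) hc hf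
    (![2, 3, 0] : Fin 3 → Fin 4)
  have h2 := IsRel.reindex (P := fun v : Fin 3 → M => (v 0, v 1) ∈ P ∧ v 2 = g (v 0, v 1)) hc hg
    (![2, 3, 1] : Fin 3 → Fin 4)
  refine (IsRel.ex hc (P := fun (v : Fin 2 → M) x => ∃ y, ((x, y) ∈ P ∧ v 0 = f (x, y)) ∧
    ((x, y) ∈ P ∧ v 1 = g (x, y))) (IsRel.ex hc (P := fun (v : Fin 3 → M) y =>
      ((v 2, y) ∈ P ∧ v 0 = f (v 2, y)) ∧ ((v 2, y) ∈ P ∧ v 1 = g (v 2, y)))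
        (h1.and hc h2))).congr fun v => ?_
  constructor
  · rintro ⟨x, y, ⟨hxy, e0⟩, -, e1⟩
    refine ⟨e0 ▸ hfb.mapsTo hxy, ?_⟩
    rw [e1, e0, Function.comp, hinv.1 hxy]
  · rintro ⟨h0, h1⟩
    exact ⟨(Function.invFunOn f P (v 0)).1, (Function.invFunOn f P (v 0)).2,
      ⟨hmaps h0, (hinv.2 h0).symm⟩, hmaps h0, h1⟩

/-- The Schröder–Bernstein theorem inside the structure. -/
theorem IsWellBehaved.antisymm (hS : S.IsWellBehaved) {A B : Set M} (h : S.CardLE A B)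
    (h' : S.CardLE B A) : S.CardEq A B := by
  have hc := hS.comprehension
  have hA := h.left_isC hc
  have hB := h'.left_isC hc
  by_cases hfin : S.DedekindFinite B
  · obtain ⟨C, hCB, hC, e⟩ := h.exists_subset hc
    rwa [← hfin.eq_of_subset hC hCB (h'.trans hc e.le)]
  · have hBi : S.DedekindInfinite B := not_not.1 hfin
    obtain ⟨a, b, hab⟩ := hBi.exists_ne
    -- Each cardinal is the maximum of the two, so the disjoint sum is in bijection with both.
    have := hS.infiniteSums hA.toConcept hB.toConcept (hBi.mono hc hA h') hBi a b hab
    exact (this.2 h').cardEq hc (this.1 h)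

/-- The halves are the images of the two summands under a bijection of `N ⊔ N` with `N`. -/
theorem DedekindInfinite.exists_halves (hS : S.IsWellBehaved) {N : Set M}
    (hN : S.DedekindInfinite N) (hNC : S.IsC N) :
    ∃ A B : Set M, Disjoint A B ∧ A ∪ B = N ∧ S.CardEq N A ∧ S.CardEq N B := by
  have hc := hS.comprehension
  obtain ⟨a, b, hab⟩ := hN.exists_ne
  obtain ⟨f, hf, hb⟩ := (hS.infiniteSums hNC.toConcept hNC.toConcept hN hN a b hab).1
    (CardEq.refl hc hNC).le
  simp only [IsC.carrier_toConcept] at hf hb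
  set P := ({a} ×ˢ N ∪ {b} ×ˢ N : Set (M × M))
  have key (c : M) (hP : ∀ x ∈ N, (c, x) ∈ P) :
      S.CardEq N ((fun x => f (c, x)) '' N) := by
    refine ⟨fun x => f (c, x), ?_, Set.InjOn.bijOn_image fun x hx y hy h => ?_⟩
    · have h1 := IsRel.reindex (P := fun v : Fin 3 → M => (v 0, v 1) ∈ P ∧ v 2 = f (v 0, v 1))
        hc hf (![2, 0, 1] : Fin 3 → Fin 3)
      refine ((IsRel.ex hc (P := fun (v : Fin 2 → M) u => u = c ∧
        ((u, v 0) ∈ P ∧ v 1 = f (u, v 0))) ((IsRel.eq_const hc (Fin.last 2) c).and hc h1)).and hc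
          (hNC.mem hc 0)).congr fun v => ?_
      have := hP (v 0)
      simp
      tauto
    · exact (Prod.ext_iff.1 (hb.injOn (hP x hx) (hP y hy) h)).2
  refine ⟨(fun x => f (a, x)) '' N, (fun x => f (b, x)) '' N, ?_, ?_,
    key a fun x hx => .inl ⟨rfl, hx⟩, key b fun x hx => .inr ⟨rfl, hx⟩⟩
  · rw [Set.disjoint_left]
    rintro _ ⟨x, hx, rfl⟩ ⟨y, hy, h⟩
    have hy' : (b, y) ∈ P := .inr ⟨rfl, hy⟩
    have hx' : (a, x) ∈ P := .inl ⟨rfl, hx⟩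
    exact hab (Prod.ext_iff.1 (hb.injOn hy' hx' h)).1.symm
  · conv_rhs => rw [← hb.image_eq]
    simp only [P, Set.image_union, Set.singleton_prod, Set.image_image]

/-- Finite cancellation, first for finite concepts. -/
theorem CardEq.diff_of_finite (hS : S.IsWellBehaved) {A A' Q Q' : Set M} (h : S.CardEq A A')
    (hQ : S.CardEq Q Q') (hQA : Q ⊆ A) (hQA' : Q' ⊆ A') (hfin : S.DedekindFinite A) :
    S.CardEq (A \ Q) (A' \ Q') := by
  have hc := hS.comprehension
  have key {A A' Q Q' : Set M} (h : S.CardEq A A') (hQ : S.CardEq Q Q') (hQA : Q ⊆ A)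
      (hQA' : Q' ⊆ A') (hfin : S.DedekindFinite A') (hle : S.CardLE (A \ Q) (A' \ Q')) :
      S.CardEq (A \ Q) (A' \ Q') := by
    -- The copy `C` of `A \ Q` together with `Q'` is a part of the finite `A'` as large as `A'`,
    -- hence all of it; so `C = A' \ Q'`.
    obtain ⟨C, hCB, hC, e⟩ := hle.exists_subset hc
    have hd : Disjoint C Q' := Set.disjoint_sdiff_left.mono_left hCB
    have e' := e.union hc hQ Set.disjoint_sdiff_left hd
    rw [Set.sdiff_union_of_subset hQA] at e'
    have := hfin.eq_of_subset (hC.union hc ((hQ.symm hc).left_isC hc))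
      (Set.union_subset (hCB.trans Set.sdiff_subset) hQA') ((h.symm hc).trans hc e').le
    rwa [← this, Set.union_sdiff_right, hd.sdiff_eq_left]
  have hA := h.left_isC hc
  have hA' := (h.symm hc).left_isC hc
  rcases hS.total (hA.diff hc (hQ.left_isC hc)) (hA'.diff hc ((hQ.symm hc).left_isC hc))
    with hle | hle
  · exact key h hQ hQA hQA' (hfin.mono hc hA (h.symm hc).le) hle
  · exact (key (h.symm hc) (hQ.symm hc) hQA' hQA hfin hle).symm hc

/-- Equinumerous finite parts can be cancelled. -/
theorem CardEq.diff (hS : S.IsWellBehaved) {A A' Q Q' : Set M} (h : S.CardEq A A')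
    (hQ : S.CardEq Q Q') (hQA : Q ⊆ A) (hQA' : Q' ⊆ A') (hfin : S.DedekindFinite Q) :
    S.CardEq (A \ Q) (A' \ Q') := by
  have hc := hS.comprehension
  have hA' := (h.symm hc).left_isC hc
  obtain ⟨f, hf, hb⟩ := h
  have hQC := hQ.left_isC hc
  have hQC' := (hQ.symm hc).left_isC hc
  have e1 : S.CardEq (A \ Q) (A' \ f '' Q) := by
    have := hf.cardEq_image hc hb.injOn ((hf.isC hc).diff hc hQC) Set.sdiff_subset
    rwa [hb.injOn.image_sdiff_subset hQA, hb.image_eq] at this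
  have e2 := hf.cardEq_image hc hb.injOn hQC hQA
  -- Both removed sets now lie in `A'`. Outside their union the two remainders agree; the other
  -- parts are `Q' \ f '' Q` and `f '' Q \ Q'`, equinumerous by finite cancellation of the
  -- intersection.
  refine e1.trans hc ?_
  have hfQ := hf.image' hc hQC hQA
  have hR : S.CardEq (Q' \ f '' Q) (f '' Q \ Q') := by
    have := ((e2.symm hc).trans hc hQ).diff_of_finite hS (CardEq.refl hc (hfQ.inter hc hQC'))
      Set.inter_subset_left Set.inter_subset_right
      (hfin.mono hc hQC (e2.symm hc).le)
    rw [Set.sdiff_self_inter, Set.sdiff_inter_self_eq_sdiff] at this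
    exact this.symm hc
  have := (CardEq.refl hc (hA'.diff hc (hfQ.union hc hQC'))).union hc hR
    (Set.disjoint_left.2 fun x h1 h2 => h1.2 (.inr h2.1))
    (Set.disjoint_left.2 fun x h1 h2 => h1.2 (.inl h2.1))
  have hs : f '' Q ⊆ A' := (Set.image_mono hQA).trans hb.image_eq.subset
  convert this using 1 <;> ext x <;> have h1 := @hs x <;> have h2 := @hQA' x <;>
    simp only [Set.mem_union, Set.mem_sdiff] <;> tauto

/-- If `N = A ∪ B` were infinite, it would have a bijection `f` onto a proper half. Cancelling the
finite `A` against `f '' A` gives `|B \ A| = |N \ f '' A|`, but `f` embeds `B \ A` in `N \ f '' A`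
and misses the other half, so `B \ A` would be infinite. -/
theorem DedekindFinite.union (hS : S.IsWellBehaved) {A B : Set M} (hA : S.DedekindFinite A)
    (hB : S.DedekindFinite B) (hAC : S.IsC A) (hBC : S.IsC B) : S.DedekindFinite (A ∪ B) := by
  have hc := hS.comprehension
  intro hN
  obtain ⟨N₁, N₂, hd, hu, e₁, e₂⟩ := hN.exists_halves hS (hAC.union hc hBC)
  obtain ⟨f, hf, hb⟩ := e₁
  have hN2 : N₂.Nonempty := by
    rw [Set.nonempty_iff_ne_empty]
    rintro rfl
    have := e₂.eq_empty
    obtain ⟨Y, hY, -⟩ := hN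
    exact (Set.exists_of_ssubset hY).elim fun a ha => by simp_all
  have hA1 := hf.cardEq_image hc hb.injOn hAC Set.subset_union_left
  have hsub : f '' A ⊆ A ∪ B :=
    ((Set.image_mono Set.subset_union_left).trans hb.image_eq.subset).trans
      (hu ▸ Set.subset_union_left)
  have e := (CardEq.refl hc (hAC.union hc hBC)).diff hS hA1 Set.subset_union_left hsub hA
  rw [Set.union_sdiff_left] at e
  have hD := hBC.diff hc hAC
  have hfD := hf.image' hc hD (Set.sdiff_subset.trans Set.subset_union_right)
  refine (hB.subset hc hBC hD Set.sdiff_subset).mono hc hD (e.symm hc).le ⟨hfD.toConcept, ?_,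
    (e.symm hc).le.trans hc (hf.cardEq_image hc hb.injOn hD
      (Set.sdiff_subset.trans Set.subset_union_right)).le⟩
  obtain ⟨z, hz⟩ := hN2
  have hnz : ∀ x ∈ A ∪ B, f x ≠ z := fun x hx h =>
    Set.disjoint_left.1 hd (hb.mapsTo hx) (h ▸ hz)
  refine (Set.ssubset_iff_of_subset ?_).2 ⟨z, ⟨hu ▸ .inr hz, ?_⟩, ?_⟩
  · rintro _ ⟨x, hx, rfl⟩
    refine ⟨hu ▸ .inl (hb.mapsTo (.inr hx.1)), ?_⟩
    rintro ⟨y, hy, hyx⟩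
    exact hx.2 (hb.injOn (.inl hy) (.inr hx.1) hyx ▸ hy)
  · rintro ⟨x, hx, h⟩
    exact hnz x (.inl hx) h
  · rintro ⟨x, hx, h⟩
    exact hnz x (.inr hx.1) h

theorem DedekindInfinite.union_le (hS : S.IsWellBehaved) {K A B : Set M}
    (hK : S.DedekindInfinite K) (hKC : S.IsC K) (hA : S.CardLE A K) (hB : S.CardLE B K) :
    S.CardLE (A ∪ B) K := by
  have hc := hS.comprehension
  obtain ⟨N₁, N₂, hd, hu, e₁, e₂⟩ := hK.exists_halves hS hKC
  have := (hA.trans hc e₁.le).union hc (hB.trans hc e₂.le) hd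
  rwa [hu] at this

/-- The larger of `A` and `B` is infinite, as finite concepts have finite unions, and so it absorbs
the smaller. -/
theorem DedekindInfinite.le_union (hS : S.IsWellBehaved) {K A B : Set M}
    (hK : S.DedekindInfinite K) (hA : S.IsC A) (hB : S.IsC B) (h : S.CardLE K (A ∪ B)) :
    S.CardLE K A ∨ S.CardLE K B := by
  have hc := hS.comprehension
  have key {A B : Set M} (hA : S.IsC A) (hB : S.IsC B) (h : S.CardLE K (A ∪ B))
      (hle : S.CardLE A B) : S.CardLE K B := by
    by_cases hfin : S.DedekindFinite B
    · exact absurd (hK.mono hc (hA.union hc hB) h)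
        ((hfin.mono hc hB hle).union hS hfin hA hB)
    · exact h.trans hc (DedekindInfinite.union_le hS (not_not.1 hfin) hB hle
        (CardEq.refl hc hB).le)
  rcases hS.total hA hB with hle | hle
  · exact .inr (key hA hB h hle)
  · exact .inl (key hB hA (Set.union_comm A B ▸ h) hle)

/-- If `K` fits into `T`, it is copied into one half of `T`, and the other half keeps the remainder
as large as `T`. Otherwise the empty part serves. -/
theorem DedekindInfinite.exists_part (hS : S.IsWellBehaved) {K T : Set M}
    (hK : S.DedekindInfinite K) (hT : S.IsC T) :
    ∃ U ⊆ T, S.IsC U ∧ S.CardLE U K ∧ (S.CardLE K T → S.CardEq K U ∧ S.CardEq T (T \ U)) := by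
  have hc := hS.comprehension
  by_cases h : S.CardLE K T
  · obtain ⟨N₁, N₂, hd, hu, e₁, e₂⟩ := (hK.mono hc hT h).exists_halves hS hT
    obtain ⟨U, hU, hUC, e⟩ := (h.trans hc e₁.le).exists_subset hc
    have hUT : U ⊆ T := hu ▸ hU.trans Set.subset_union_left
    refine ⟨U, hUT, hUC, (e.symm hc).le, fun _ => ⟨e, hS.antisymm ?_ ?_⟩⟩
    · refine e₂.le.trans hc (.of_subset hc ((e₂.symm hc).left_isC hc) fun x hx => ⟨?_, ?_⟩)
      · exact hu ▸ .inr hx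
      · exact fun hxU => Set.disjoint_left.1 hd (hU hxU) hx
    · exact .of_subset hc (hT.diff hc hUC) Set.sdiff_subset
  · obtain ⟨a⟩ := ‹Nonempty M›
    exact ⟨∅, Set.empty_subset _, .empty hc, .of_subset hc (.empty hc) (Set.empty_subset _),
      fun h' => absurd h' h⟩

end

end SOStructure

namespace SOStructure

variable {M : Type u} {S : SOStructure M}

/-! ### Coverings by finitely many small concepts -/

/-- `X` is covered by finitely many concepts of cardinality at most `|Y|`. -/
def Cov (S : SOStructure M) (X Y : Set M) : Prop :=
  ∃ F : Set (Set M), F.Finite ∧ (∀ A ∈ F, S.CardLE A Y) ∧ X ⊆ ⋃₀ F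

theorem Cov.of_le {X Y : Set M} (h : S.CardLE X Y) : S.Cov X Y :=
  ⟨{X}, Set.finite_singleton X, by simpa using h, by simp⟩

theorem Cov.subset {X X' Y : Set M} (h : S.Cov X Y) (hX : X' ⊆ X) : S.Cov X' Y :=
  let ⟨F, hF, h1, h2⟩ := h
  ⟨F, hF, h1, hX.trans h2⟩

theorem Cov.union {X X' Y : Set M} (h : S.Cov X Y) (h' : S.Cov X' Y) : S.Cov (X ∪ X') Y := by
  obtain ⟨F, hF, h1, h2⟩ := h
  obtain ⟨F', hF', h1', h2'⟩ := h'
  refine ⟨F ∪ F', hF.union hF', fun A hA => hA.elim (h1 A) (h1' A), ?_⟩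
  rw [Set.sUnion_union]
  exact Set.union_subset_union h2 h2'

theorem Cov.sUnion {F : Set (Set M)} {Y : Set M} (hF : F.Finite) (h : ∀ A ∈ F, S.Cov A Y) :
    S.Cov (⋃₀ F) Y := by
  induction F, hF using Set.Finite.induction_on with
  | empty => exact ⟨∅, Set.finite_empty, by simp, by simp⟩
  | insert _ _ ih =>
    rw [Set.sUnion_insert]
    exact (h _ (.inl rfl)).union (ih fun A hA => h A (.inr hA))

theorem Cov.nonempty {X Y : Set M} (h : S.Cov X Y) (hX : X.Nonempty) : Y.Nonempty := by
  obtain ⟨F, -, h1, h2⟩ := h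
  obtain ⟨x, hx⟩ := hX
  obtain ⟨A, hA, hxA⟩ := h2 hx
  obtain ⟨f, -, hm, -⟩ := h1 A hA
  exact ⟨_, hm hxA⟩

theorem image_of_swap {π : Equiv.Perm M} {P Q Z : Set M} (h1 : π '' P = Q)
    (h3 : ∀ x, x ∉ P → x ∉ Q → π x = x) (hP : P ⊆ Z) (hQ : Disjoint Q Z) :
    π '' Z = Z \ P ∪ Q := by
  have h : π '' (Z \ P) = Z \ P := by
    have : Set.EqOn π id (Z \ P) := fun x hx => h3 x hx.2 fun hxQ => Set.disjoint_left.1 hQ hxQ hx.1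
    rw [this.image_eq, Set.image_id]
  conv_lhs => rw [← Set.sdiff_union_of_subset hP, Set.image_union, h, h1]

theorem image_of_swap_eq {π : Equiv.Perm M} {P Q Y : Set M} (h1 : π '' P = Q) (h2 : π '' Q = P)
    (h3 : ∀ x, x ∉ P → x ∉ Q → π x = x) (h : P ∪ Q ⊆ Y ∨ Disjoint (P ∪ Q) Y) : π '' Y = Y := by
  rcases h with h | h
  · have e : π '' (Y \ (P ∪ Q)) = Y \ (P ∪ Q) := by
      have : Set.EqOn π id (Y \ (P ∪ Q)) := fun x hx =>
        h3 x (fun h => hx.2 (.inl h)) (fun h => hx.2 (.inr h))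
      rw [this.image_eq, Set.image_id]
    conv_lhs =>
      rw [← Set.sdiff_union_of_subset h, Set.image_union, e, Set.image_union, h1, h2,
        Set.union_comm Q P, Set.sdiff_union_of_subset h]
  · have : Set.EqOn π id Y := fun x hx =>
      h3 x (fun h' => Set.disjoint_left.1 h (.inl h') hx)
        (fun h' => Set.disjoint_left.1 h (.inr h') hx)
    rw [this.image_eq, Set.image_id]

section
variable [Nonempty M]

theorem Cov.of_finite (hc : S.Comprehension) {X Y : Set M} (hX : X.Finite) (hY : Y.Nonempty) :
    S.Cov X Y := by
  refine ⟨(fun x => {x}) '' X, hX.image _, ?_, fun x hx => ⟨{x}, ⟨x, hx, rfl⟩, rfl⟩⟩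
  rintro _ ⟨x, -, rfl⟩
  exact CardLE.singleton hc x hY

theorem Cov.trans (hc : S.Comprehension) {X Y Z : Set M} (h : S.Cov X Y) (h' : S.Cov Y Z) :
    S.Cov X Z := by
  obtain ⟨F, hF, h1, h2⟩ := h
  obtain ⟨G, hG, h1', h2'⟩ := h'
  refine (Cov.sUnion hF fun A hA => ?_).subset h2
  obtain ⟨f, hf, hm, hi⟩ := h1 A hA
  refine ⟨(fun B => A ∩ f ⁻¹' B) '' G, hG.image _, ?_, fun x hx => ?_⟩
  · rintro _ ⟨B, hB, rfl⟩
    have hAB := hf.preimage hc ((h1' B hB).left_isC hc)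
    exact CardLE.trans hc ⟨f, hf.mono hc hAB Set.inter_subset_left, fun x hx => hx.2,
      hi.mono Set.inter_subset_left⟩ (h1' B hB)
  · obtain ⟨B, hB, hxB⟩ := h2' (hm hx)
    exact ⟨_, ⟨B, hB, rfl⟩, hx, hxB⟩

/-- An infinite cardinal below a finite union is below one of its members. -/
theorem Cov.le_of_infinite (hS : S.IsWellBehaved) {X Y : Set M} (hX : S.DedekindInfinite X)
    (hXC : S.IsC X) (h : S.Cov X Y) : S.CardLE X Y := by
  have hc := hS.comprehension
  obtain ⟨F, hF, h1, h2⟩ := h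
  suffices H : S.IsC (⋃₀ F) ∧ (S.CardLE X (⋃₀ F) → S.CardLE X Y) from
    H.2 (.of_subset hc hXC h2)
  clear h2
  induction F, hF using Set.Finite.induction_on with
  | empty =>
    rw [Set.sUnion_empty]
    refine ⟨.empty hc, fun ⟨f, _, hm, _⟩ => ?_⟩
    obtain ⟨Y, hY, -⟩ := hX
    obtain ⟨a, ha, -⟩ := Set.exists_of_ssubset hY
    exact (hm ha).elim
  | insert _ _ ih =>
    rw [Set.sUnion_insert]
    obtain ⟨i1, i2⟩ := ih fun A hA => h1 A (.inr hA)
    have hA := (h1 _ (.inl rfl)).left_isC hc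
    refine ⟨hA.union hc i1, fun hle => ?_⟩
    rcases hX.le_union hS hA i1 hle with h | h
    · exact h.trans hc (h1 _ (.inl rfl))
    · exact i2 h

theorem CardLEPair.of_cover (hc : S.Comprehension) {F : Set (Set M)} {Y : Set M} (hF : F.Finite)
    (h : ∀ A ∈ F, S.CardLE A Y) {X Z : Set M} (hX : S.IsC X) (hXF : X ⊆ ⋃₀ F) (hZ : Z.Finite)
    (hle : F.ncard ≤ Z.ncard) : S.CardLEPair X (Z ×ˢ Y) := by
  classical
  induction F, hF using Set.Finite.induction_on generalizing X Z with
  | empty =>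
    rw [Set.sUnion_empty, Set.subset_empty_iff] at hXF
    subst hXF
    refine ⟨fun x => (x, x), ?_, fun x hx => hx.elim, Set.injOn_empty _⟩
    exact ((IsC.empty hc).mem hc (0 : Fin 3)).congr fun v => by simp
  | @insert A F hAF hF ih =>
    rw [Set.ncard_insert_of_notMem hAF hF] at hle
    obtain ⟨z, hz⟩ : Z.Nonempty := (Set.ncard_pos hZ).1 (by omega)
    obtain ⟨g, hg, hgm, hgi⟩ := h A (.inl rfl)
    have hA := hg.isC hc
    obtain ⟨f, hf, hfm, hfi⟩ := ih (fun B hB => h B (.inr hB)) (hX.diff hc hA)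
      (Set.sdiff_subset_iff.2 (by rwa [Set.sUnion_insert] at hXF)) (hZ.subset Set.sdiff_subset)
      (Z := Z \ {z}) (by rw [Set.ncard_sdiff_singleton_of_mem hz]; omega)
    refine ⟨fun x => if x ∈ A then (z, g x) else f x, ?_, ?_, ?_⟩
    · have hg' := (hX.mem hc (0 : Fin 3)).and hc ((hg.rel hc 0 2).and hc (IsRel.eq_const hc 1 z))
      refine (hg'.or hc hf).congr fun v => ?_
      by_cases hv : v 0 ∈ A
      · simp [hv]
        tauto
      · simp [hv]
    · intro x hx
      by_cases hxA : x ∈ A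
      · simp only [hxA, if_true]
        exact ⟨hz, hgm hxA⟩
      · simp only [hxA, if_false]
        have := hfm ⟨hx, hxA⟩
        exact ⟨this.1.1, this.2⟩
    · intro x hx y hy hxy
      by_cases hxA : x ∈ A <;> by_cases hyA : y ∈ A <;>
        simp only [hxA, hyA, if_true, if_false] at hxy
      · exact hgi hxA hyA (Prod.ext_iff.1 hxy).2
      · exact absurd (Prod.ext_iff.1 hxy).1.symm (hfm ⟨hy, hyA⟩).1.2
      · exact absurd (Prod.ext_iff.1 hxy).1 (hfm ⟨hx, hxA⟩).1.2
      · exact hfi ⟨hx, hxA⟩ ⟨hy, hyA⟩ hxy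

/-- An injection into `Z × Y` splits `X` into its fibres over the finitely many tags in `Z`;
conversely, each member of a cover receives its own tag. -/
theorem triLE_iff_cov (hc : S.Comprehension) {X Y : Set M} (hX : S.IsC X) :
    S.TriLE X Y ↔ S.Cov X Y := by
  constructor
  · rintro ⟨n, Z, hZ, f, hf, hm, hi⟩
    have hfin : Z.carrier.Finite := Set.finite_of_encard_eq_coe hZ
    refine ⟨(fun z => {x ∈ X | (f x).1 = z}) '' Z.carrier, hfin.image _, ?_, fun x hx =>
      ⟨_, ⟨(f x).1, (hm hx).1, rfl⟩, hx, rfl⟩⟩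
    rintro _ ⟨z, hz, rfl⟩
    refine ⟨fun x => (f x).2, ?_, fun x hx => (hm hx.1).2, fun x hx y hy h =>
      hi hx.1 hy.1 (Prod.ext (hx.2.trans hy.2.symm) h)⟩
    have h1 := IsRel.reindex (P := fun v : Fin 3 → M => v 0 ∈ X ∧ (v 1, v 2) = f (v 0)) hc hf
      (![0, 2, 1] : Fin 3 → Fin 3)
    refine (IsRel.ex hc (P := fun (v : Fin 2 → M) u => u = z ∧ (v 0 ∈ X ∧ (u, v 1) = f (v 0)))
      ((IsRel.eq_const hc (Fin.last 2) z).and hc h1)).congr fun v => ?_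
    simp [Prod.ext_iff]
    grind
  · rintro ⟨F, hF, h1, h2⟩
    by_cases h : ∃ Z : Set M, Z.Finite ∧ Z.ncard = F.ncard
    · obtain ⟨Z, hZ, e⟩ := h
      exact ⟨Z.ncard, (IsC.of_finite hc hZ).toConcept, (hZ.cast_ncard_eq).symm,
        CardLEPair.of_cover hc hF h1 hX h2 hZ e.ge⟩
    -- If `M` has too few elements to tag the cover, then `M` is finite and each element of `X` can
    -- be its own tag.
    · have hMfin : (Set.univ : Set M).Finite := by
        by_contra hinf
        obtain ⟨Z, -, hZ, e⟩ := Set.Infinite.exists_subset_ncard_eq hinf F.ncard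
        exact h ⟨Z, hZ, e⟩
      refine ⟨Set.univ.ncard, (IsC.univ hc).toConcept, hMfin.cast_ncard_eq.symm, ?_⟩
      rcases X.eq_empty_or_nonempty with rfl | hne
      · exact CardLEPair.of_cover hc Set.finite_empty (by simp) (.empty hc) (by simp) hMfin
          (by simp)
      · obtain ⟨y, hy⟩ := Cov.nonempty ⟨F, hF, h1, h2⟩ hne
        refine ⟨fun x => (x, y), ?_, fun x _ => ⟨trivial, hy⟩, fun x _ z _ hxz =>
          (Prod.ext_iff.1 hxz).1⟩
        refine ((hX.mem hc (0 : Fin 3)).and hc ((IsRel.eq hc 1 0).and hc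
          (IsRel.eq_const hc 2 y))).congr fun v => by simp

/-- By comparability the failure of `⊲` yields a positive covering statement, which is the form in
which non-complementativity is used. -/
theorem Cov.of_not_triLT (hS : S.IsWellBehaved) {X Y : Set M} (hX : S.IsC X) (hY : S.IsC Y)
    (h : ¬ S.TriLT Y X) : S.Cov X Y := by
  have hc := hS.comprehension
  rw [TriLT, triLE_iff_cov hc hX, triLE_iff_cov hc hY] at h
  rcases hS.total hX hY with hle | hle
  · exact .of_le hle
  · exact not_not.1 fun h' => h ⟨.of_le hle, h'⟩

theorem Cov.not_triLT (hc : S.Comprehension) {X Y : Set M} (hX : S.IsC X)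
    (h : S.Cov X Y) : ¬ S.TriLT Y X := fun h' => h'.2 ((triLE_iff_cov hc hX).2 h)

/-! ### Permutations of the structure -/

theorem exists_perm (hc : S.Comprehension) {A A' B B' C C' D D' : Set M} (hA : S.CardEq A A')
    (hB : S.CardEq B B') (hC : S.CardEq C C') (hD : S.CardEq D D') (hAB : Disjoint A B)
    (hCD : Disjoint C D) (hAB' : Disjoint A' B') (hCD' : Disjoint C' D')
    (h : (A ∪ B)ᶜ = C ∪ D) (h' : (A' ∪ B')ᶜ = C' ∪ D') :
    ∃ π : Equiv.Perm M, S.HasFun π Set.univ ∧ π '' A = A' ∧ π '' B = B' ∧ π '' C = C' := by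
  obtain ⟨a, ha, ha'⟩ := hA
  obtain ⟨b, hb, hb'⟩ := hB
  obtain ⟨c, hc1, hc'⟩ := hC
  obtain ⟨d, hd, hd'⟩ := hD
  obtain ⟨f, hf, hfb, fa, fb⟩ := exists_glue hc ha hb ha' hb' hAB hAB'
  obtain ⟨g, hg, hgb, gc, -⟩ := exists_glue hc hc1 hd hc' hd' hCD hCD'
  obtain ⟨k, hk, hkb, kf, kg⟩ := exists_glue hc hf hg hfb hgb
    (h ▸ disjoint_compl_right) (h' ▸ disjoint_compl_right)
  rw [← h, Set.union_compl_self] at hk hkb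
  rw [← h', Set.union_compl_self] at hkb
  refine ⟨Equiv.ofBijective k (Set.bijOn_univ.1 hkb), hk, ?_, ?_, ?_⟩
  · exact (((kf.mono Set.subset_union_left).trans fa).image_eq).trans ha'.image_eq
  · exact (((kf.mono Set.subset_union_right).trans fb).image_eq).trans hb'.image_eq
  · exact (((kg.mono Set.subset_union_left).trans gc).image_eq).trans hc'.image_eq

theorem exists_swap (hc : S.Comprehension) {P Q : Set M} (h : S.CardEq P Q)
    (hd : Disjoint P Q) :
    ∃ π : Equiv.Perm M, S.HasFun π Set.univ ∧ π '' P = Q ∧ π '' Q = P ∧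
      ∀ x, x ∉ P → x ∉ Q → π x = x := by
  have hP := h.left_isC hc
  have hQ := (h.symm hc).left_isC hc
  obtain ⟨f, hf, hfb⟩ := h
  obtain ⟨g, hg, hgb⟩ := (CardEq.symm hc ⟨f, hf, hfb⟩ : S.CardEq Q P)
  obtain ⟨k, hk, hkb, k1, k2⟩ := exists_glue hc hf hg hfb hgb hd hd.symm
  have hR := (hP.union hc hQ).compl hc
  obtain ⟨π, hπ, hπb, p1, p2⟩ := exists_glue hc hk (.id hc hR) hkb
    (Set.bijOn_id _) disjoint_compl_right (by rw [Set.union_comm Q P]; exact disjoint_compl_right)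
  rw [Set.union_compl_self] at hπ hπb
  rw [Set.union_comm Q P, Set.union_compl_self] at hπb
  refine ⟨Equiv.ofBijective π (Set.bijOn_univ.1 hπb), hπ, ?_, ?_, fun x hx hx' => ?_⟩
  · exact (((p1.mono Set.subset_union_left).trans k1).image_eq).trans hfb.image_eq
  · exact (((p1.mono Set.subset_union_right).trans k2).image_eq).trans hgb.image_eq
  · exact p2 (x := x) (by simp [hx, hx'])

/-! ### Bicardinal equivalence -/

theorem Bicard.refl (hc : S.Comprehension) (X : S.Concept) : S.Bicard X X :=
  ⟨.refl hc X.isC, .refl hc (X.isC.compl hc)⟩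

theorem Bicard.symm (hc : S.Comprehension) {X Y : S.Concept} (h : S.Bicard X Y) : S.Bicard Y X :=
  ⟨h.1.symm hc, h.2.symm hc⟩

theorem Bicard.trans (hc : S.Comprehension) {X Y Z : S.Concept} (h : S.Bicard X Y)
    (h' : S.Bicard Y Z) : S.Bicard X Z :=
  ⟨h.1.trans hc h'.1, h.2.trans hc h'.2⟩

theorem Bicard.of_perm (hc : S.Comprehension) {π : Equiv.Perm M} (hπ : S.HasFun π Set.univ)
    {X Y : S.Concept} (h : Y.carrier = π '' X.carrier) : S.Bicard X Y := by
  constructor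
  · rw [h]
    exact hπ.cardEq_image hc π.injective.injOn X.isC (Set.subset_univ _)
  · rw [h, ← Set.image_compl_eq π.bijective]
    exact hπ.cardEq_image hc π.injective.injOn (X.isC.compl hc) (Set.subset_univ _)

theorem Bicard.of_swap (hc : S.Comprehension) {Z W : S.Concept} {P Q : Set M}
    (h : S.CardEq P Q) (hP : P ⊆ Z.carrier) (hQ : Disjoint Q Z.carrier)
    (hW : W.carrier = Z.carrier \ P ∪ Q) : S.Bicard Z W := by
  obtain ⟨π, hπ, h1, -, h3⟩ := exists_swap hc h (hQ.mono_right hP).symm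
  exact .of_perm hc hπ (hW.trans (image_of_swap h1 h3 hP hQ).symm)

theorem Bicard.diff (hS : S.IsWellBehaved) {Y Z : S.Concept} (h : S.Bicard Y Z)
    (hfin : S.DedekindFinite Y.carrier) :
    S.CardEq (Y.carrier \ Z.carrier) (Z.carrier \ Y.carrier) := by
  have hc := hS.comprehension
  have hi := Y.isC.inter hc Z.isC
  have := h.1.diff hS (.refl hc hi) Set.inter_subset_left Set.inter_subset_right
    (hfin.subset hc Y.isC hi Set.inter_subset_left)
  rwa [Set.sdiff_self_inter, Set.sdiff_inter_self_eq_sdiff] at this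

/-! ### Permutation-invariant relations -/

variable {E : S.Concept → S.Concept → Prop}

/-- Whether `E` holds depends only on the cardinalities of the four Boolean combinations. -/
theorem PermInvariant.iff_of_cardEq (hc : S.Comprehension) (hE : S.PermInvariant E)
    {Y Z Y' Z' : S.Concept}
    (h1 : S.CardEq (Y.carrier ∩ Z.carrier) (Y'.carrier ∩ Z'.carrier))
    (h2 : S.CardEq (Y.carrier \ Z.carrier) (Y'.carrier \ Z'.carrier))
    (h3 : S.CardEq (Z.carrier \ Y.carrier) (Z'.carrier \ Y'.carrier))
    (h4 : S.CardEq (Y.carrier ∪ Z.carrier)ᶜ (Y'.carrier ∪ Z'.carrier)ᶜ) : E Y Z ↔ E Y' Z' := by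
  have key (Y Z : Set M) : (Y ∩ Z ∪ Y \ Z)ᶜ = Z \ Y ∪ (Y ∪ Z)ᶜ := by
    ext x
    simp only [Set.mem_compl_iff, Set.mem_union, Set.mem_inter_iff, Set.mem_sdiff]
    tauto
  have hd (Y Z : Set M) : Disjoint (Z \ Y) (Y ∪ Z)ᶜ :=
    Set.disjoint_left.2 fun x hx hx' => hx' (.inr hx.1)
  have hd' (Y Z : Set M) : Disjoint (Y ∩ Z) (Y \ Z) :=
    Set.disjoint_left.2 fun x hx hx' => hx'.2 hx.2
  obtain ⟨π, hπ, p1, p2, p3⟩ := exists_perm hc h1 h2 h3 h4 (hd' _ _) (hd _ _) (hd' _ _) (hd _ _)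
    (key _ _) (key _ _)
  refine hE π hπ Y Z Y' Z' ?_ ?_
  · conv_rhs => rw [← Set.inter_union_sdiff Y.carrier Z.carrier, Set.image_union, p1, p2,
      Set.inter_union_sdiff]
  · conv_rhs => rw [← Set.inter_union_sdiff Z.carrier Y.carrier, Set.image_union,
      Set.inter_comm, p1, p3, Set.inter_comm, Set.inter_union_sdiff]

theorem PermInvariant.of_swap (hc : S.Comprehension) (hE : S.PermInvariant E)
    {Y Z W : S.Concept} (h : E Y Z) {P Q : Set M} (hPQ : S.CardEq P Q) (hP : P ⊆ Z.carrier)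
    (hQ : Disjoint Q Z.carrier) (hY : P ∪ Q ⊆ Y.carrier ∨ Disjoint (P ∪ Q) Y.carrier)
    (hW : W.carrier = Z.carrier \ P ∪ Q) : E Y W := by
  obtain ⟨π, hπ, h1, h2, h3⟩ := exists_swap hc hPQ (hQ.mono_right hP).symm
  exact (hE π hπ Y Z Y W (image_of_swap_eq h1 h2 h3 hY).symm
    (hW.trans (image_of_swap h1 h3 hP hQ).symm)).1 h

/-- Chains of small swaps connect all members of a finite bicardinal class. -/
theorem rel_of_small_swaps (hS : S.IsWellBehaved) (hE : Equivalence E) {X : S.Concept}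
    (hX : S.DedekindFinite X.carrier) {m : Set M} (hm : S.Cov X.carrier m)
    (h : ∀ Y ∈ S.bicardClass X, ∀ Z ∈ S.bicardClass X,
      S.CardLE (Y.carrier \ Z.carrier) m → E Y Z)
    {Y Z : S.Concept} (hY : Y ∈ S.bicardClass X) (hZ : Z ∈ S.bicardClass X) : E Y Z := by
  have hc := hS.comprehension
  have hYZ : S.Bicard Y Z := (Bicard.symm hc hY).trans hc hZ
  have hYfin : S.DedekindFinite Y.carrier := hX.mono hc X.isC (hY.1.symm hc).le
  obtain ⟨g, hg, hgb⟩ := hYZ.diff hS hYfin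
  have hD := Y.isC.diff hc Z.isC
  obtain ⟨F, hF, hFm, hFD⟩ := ((Cov.of_le (hY.1.symm hc).le).trans hc hm).subset
    (Set.sdiff_subset : Y.carrier \ Z.carrier ⊆ Y.carrier)
  set D := Y.carrier \ Z.carrier
  have hDY : D ⊆ Y.carrier := Set.sdiff_subset
  have mem {U : Set M} (hU : S.IsC U) (hUD : U ⊆ D) {W : S.Concept}
      (hW : W.carrier = Y.carrier \ U ∪ g '' U) : W ∈ S.bicardClass X := by
    refine Bicard.trans hc hY (.of_swap hc (hg.cardEq_image hc hgb.injOn hU hUD)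
      (hUD.trans hDY) ?_ hW)
    refine Set.disjoint_left.2 ?_
    rintro _ ⟨x, hx, rfl⟩ h
    exact (hgb.mapsTo (hUD hx)).2 h
  -- Induction on the cover of `D = Y \ Z`: each new member `A` moves at most `|A| ≤ |m|` further
  -- elements along `g`, so consecutive concepts in the chain are related by `h`.
  have key : S.IsC (⋃₀ F) ∧ ∀ W : S.Concept,
      W.carrier = Y.carrier \ (D ∩ ⋃₀ F) ∪ g '' (D ∩ ⋃₀ F) → E Y W := by
    clear hFD
    induction F, hF using Set.Finite.induction_on with
    | empty =>
      refine ⟨by rw [Set.sUnion_empty]; exact .empty hc, fun W hW => ?_⟩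
      rw [Set.sUnion_empty, Set.inter_empty, Set.sdiff_empty, Set.image_empty,
        Set.union_empty] at hW
      rw [Concept.ext_carrier hW]
      exact hE.refl Y
    | @insert A F _ _ ih =>
      obtain ⟨i1, i2⟩ := ih fun A hA => hFm A (.inr hA)
      have hA := (hFm A (.inl rfl)).left_isC hc
      have hU := hD.inter hc i1
      rw [Set.sUnion_insert]
      refine ⟨hA.union hc i1, fun W hW => ?_⟩
      let V := ((Y.isC.diff hc hU).union hc (hg.image' hc hU Set.inter_subset_left)).toConcept
      refine hE.trans (i2 V rfl) (h V (mem hU Set.inter_subset_left rfl) W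
        (mem (hD.inter hc (hA.union hc i1)) Set.inter_subset_left hW) ?_)
      refine (CardLE.of_subset hc (V.isC.diff hc W.isC) ?_).trans hc (hFm A (.inl rfl))
      rw [hW]
      rintro x ⟨hx | ⟨y, hy, rfl⟩, hx'⟩
      · by_contra hxA
        exact hx' (.inl ⟨hx.1, fun h => hx.2 ⟨h.1, h.2.resolve_left hxA⟩⟩)
      · exact absurd (.inr ⟨y, ⟨hy.1, .inr hy.2⟩, rfl⟩) hx'
  refine key.2 Z ?_
  rw [Set.inter_eq_left.2 hFD, hgb.image_eq, Set.sdiff_sdiff_right_self, Set.inter_comm,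
    Set.inter_union_sdiff]

end

end SOStructure

namespace SOStructure

variable {M : Type u} {S : SOStructure M}

theorem symmDiff_compl_eq (Y Z : Set M) : (symmDiff Y Z)ᶜ = Y ∩ Z ∪ (Y ∪ Z)ᶜ := by
  ext x
  simp only [Set.mem_compl_iff, Set.mem_symmDiff, Set.mem_union, Set.mem_inter_iff]
  tauto

variable [Nonempty M] {E : S.Concept → S.Concept → Prop}

/-! ### Slices of infinite concepts -/

/-- `A` and `W` have cardinality `|X|`, with intersection and both differences of cardinality
`|X|`, and the complement of `A ∪ W` has the cardinality of the complement of `X`. -/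
def Generic (S : SOStructure M) (X A W : Set M) : Prop :=
  S.CardEq X (A ∩ W) ∧ S.CardEq X (A \ W) ∧ S.CardEq X (W \ A) ∧ S.CardEq Xᶜ (A ∪ W)ᶜ

/-- `U` is a part of `T` of cardinality at most `|K|`, and if `|K| ≤ |T|`, then it has
cardinality `|K|` and its complement in `T` has cardinality `|T|`. -/
def IsPart (S : SOStructure M) (K T U : Set M) : Prop :=
  U ⊆ T ∧ S.IsC U ∧ S.CardLE U K ∧ (S.CardLE K T → S.CardEq K U ∧ S.CardEq T (T \ U))

/-- One of `T`, `T'` already carries the cardinal of the union, so parts chosen cell by cell behave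
like a part of the whole, even when some cells are small. -/
theorem IsPart.union (hS : S.IsWellBehaved) {K T T' U U' : Set M} (hK : S.DedekindInfinite K)
    (hKC : S.IsC K) (hT : S.IsC T) (hT' : S.IsC T') (hU : S.IsPart K T U) (hU' : S.IsPart K T' U')
    (h : S.CardLE K (T ∪ T')) :
    S.CardEq K (U ∪ U') ∧ S.CardEq (T ∪ T') (T \ U ∪ T' \ U') := by
  have hc := hS.comprehension
  obtain ⟨u1, u2, u3, u4⟩ := hU
  obtain ⟨u1', u2', u3', u4'⟩ := hU'
  have hB := hT.union hc hT'
  have hBinf := hK.mono hc hB h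
  constructor
  · refine hS.antisymm ?_ (hK.union_le hS hKC u3 u3')
    rcases hK.le_union hS hT hT' h with h | h
    · exact (u4 h).1.le.trans hc (.of_subset hc u2 Set.subset_union_left)
    · exact (u4' h).1.le.trans hc (.of_subset hc u2' Set.subset_union_right)
  · have hd := hT.diff hc u2
    have hd' := hT'.diff hc u2'
    refine hS.antisymm ?_ (.of_subset hc (hd.union hc hd')
      (Set.union_subset_union Set.sdiff_subset Set.sdiff_subset))
    rcases hBinf.le_union hS hT hT' (CardEq.refl hc hB).le with h' | h'
    · exact (h'.trans hc (u4 (h.trans hc h')).2.le).trans hc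
        (.of_subset hc hd Set.subset_union_left)
    · exact (h'.trans hc (u4' (h.trans hc h')).2.le).trans hc
        (.of_subset hc hd' Set.subset_union_right)

theorem Generic.of_parts (hS : S.IsWellBehaved) {X A W T T' R R' U U' V V' : Set M}
    (hX : S.DedekindInfinite X) (hA : S.CardEq X A) (hA' : S.CardEq Xᶜ Aᶜ)
    (hle : S.CardLE X Xᶜ) (hT : S.IsC T) (hT' : S.IsC T') (hR : S.IsC R) (hR' : S.IsC R')
    (hU : S.IsPart X T U) (hU' : S.IsPart X T' U') (hV : S.IsPart X R V) (hV' : S.IsPart X R' V')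
    (hTT : Disjoint T T') (hRR : Disjoint R R') (hTA : T ∪ T' = A) (hRA : R ∪ R' = Aᶜ)
    (hW : W = (U ∪ U') ∪ (V ∪ V')) : S.Generic X A W := by
  have hc := hS.comprehension
  have hXC := hA.left_isC hc
  obtain ⟨h1, h2⟩ := hU.union hS hX hXC hT hT' hU' (hTA ▸ hA.le)
  obtain ⟨h3, h4⟩ := hV.union hS hX hXC hR hR' hV' (hRA ▸ hle.trans hc hA'.le)
  have sub : ∀ x, (x ∈ U → x ∈ T) ∧ (x ∈ U' → x ∈ T') ∧ (x ∈ V → x ∈ R) ∧ (x ∈ V' → x ∈ R') ∧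
      (x ∈ A ↔ x ∈ T ∨ x ∈ T') ∧ (x ∉ A ↔ x ∈ R ∨ x ∈ R') ∧ ¬ (x ∈ T ∧ x ∈ T') ∧
      ¬ (x ∈ R ∧ x ∈ R') := fun x =>
    ⟨fun h => hU.1 h, fun h => hU'.1 h, fun h => hV.1 h, fun h => hV'.1 h,
      (Set.ext_iff.1 hTA x).symm, (Set.ext_iff.1 hRA x).symm,
      fun h => Set.disjoint_left.1 hTT h.1 h.2, fun h => Set.disjoint_left.1 hRR h.1 h.2⟩
  have e1 : A ∩ W = U ∪ U' := by
    subst hW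
    ext x
    obtain ⟨s1, s2, s3, s4, s5, s6, s7, s8⟩ := sub x
    clear sub
    simp only [Set.mem_inter_iff, Set.mem_union]
    grind
  have e2 : A \ W = T \ U ∪ T' \ U' := by
    subst hW
    ext x
    obtain ⟨s1, s2, s3, s4, s5, s6, s7, s8⟩ := sub x
    clear sub
    simp only [Set.mem_sdiff, Set.mem_union]
    grind
  have e3 : W \ A = V ∪ V' := by
    subst hW
    ext x
    obtain ⟨s1, s2, s3, s4, s5, s6, s7, s8⟩ := sub x
    clear sub
    simp only [Set.mem_sdiff, Set.mem_union]
    grind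
  have e4 : (A ∪ W)ᶜ = R \ V ∪ R' \ V' := by
    subst hW
    ext x
    obtain ⟨s1, s2, s3, s4, s5, s6, s7, s8⟩ := sub x
    clear sub
    simp only [Set.mem_sdiff, Set.mem_union, Set.mem_compl_iff]
    grind
  refine ⟨e1 ▸ h1, ?_, e3 ▸ h3, ?_⟩
  · rw [e2]
    exact hA.trans hc (hTA ▸ h2)
  · rw [e4]
    exact hA'.trans hc (hRA ▸ h4)

theorem PermInvariant.of_generic (hc : S.Comprehension) (hE : S.PermInvariant E) {X : Set M}
    {U W U' W' : S.Concept} (h : E U W) (hU : S.Generic X U.carrier W.carrier)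
    (hU' : S.Generic X U'.carrier W'.carrier) : E U' W' :=
  (hE.iff_of_cardEq hc ((hU.1.symm hc).trans hc hU'.1) ((hU.2.1.symm hc).trans hc hU'.2.1)
    ((hU.2.2.1.symm hc).trans hc hU'.2.2.1) ((hU.2.2.2.symm hc).trans hc hU'.2.2.2)).1 h

/-- The third concept `V` takes a part from each of the four Boolean cells of `X` and `Y`, which
makes it generic to both; all generic pairs are related as soon as one is. -/
theorem rel_of_generic (hS : S.IsWellBehaved) (hE : Equivalence E) (hEp : S.PermInvariant E)
    {X Y U W : S.Concept} (hX : S.DedekindInfinite X.carrier)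
    (hle : S.CardLE X.carrier X.carrierᶜ) (h : E U W)
    (hg : S.Generic X.carrier U.carrier W.carrier) (hY : S.Bicard X Y) : E X Y := by
  have hc := hS.comprehension
  have hXC := X.isC
  have hYC := Y.isC
  obtain ⟨A, hA⟩ := hX.exists_part hS (hXC.inter hc hYC)
  obtain ⟨B, hB⟩ := hX.exists_part hS (hXC.diff hc hYC)
  obtain ⟨C, hC⟩ := hX.exists_part hS (hYC.diff hc hXC)
  obtain ⟨D, hD⟩ := hX.exists_part hS ((hXC.union hc hYC).compl hc)
  have hdXY (X Y : Set M) : Disjoint (X ∩ Y) (X \ Y) :=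
    Set.disjoint_left.2 fun x hx hx' => hx'.2 hx.2
  let V := ((hA.2.1.union hc hB.2.1).union hc (hC.2.1.union hc hD.2.1)).toConcept
  have g1 : S.Generic X.carrier X.carrier V.carrier := by
    refine Generic.of_parts hS hX (.refl hc hXC) (.refl hc (hXC.compl hc)) hle
      (hXC.inter hc hYC) (hXC.diff hc hYC) (hYC.diff hc hXC) ((hXC.union hc hYC).compl hc)
      hA hB hC hD (hdXY _ _) ?_ (Set.inter_union_sdiff _ _) ?_ rfl
    · exact Set.disjoint_left.2 fun x hx hx' => hx' (.inr hx.1)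
    · ext x
      simp only [Set.mem_sdiff, Set.mem_union, Set.mem_compl_iff]
      tauto
  have g2 : S.Generic X.carrier Y.carrier V.carrier := by
    refine Generic.of_parts hS hX hY.1 hY.2 hle
      (hXC.inter hc hYC) (hYC.diff hc hXC) (hXC.diff hc hYC) ((hXC.union hc hYC).compl hc)
      hA hC hB hD (Set.inter_comm Y.carrier X.carrier ▸ hdXY _ _) ?_ ?_ ?_ ?_
    · exact Set.disjoint_left.2 fun x hx hx' => hx' (.inl hx.1)
    · rw [Set.inter_comm, Set.inter_union_sdiff]
    · ext x
      simp only [Set.mem_sdiff, Set.mem_union, Set.mem_compl_iff]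
      tauto
    · exact Set.union_union_union_comm A B C D
  exact hE.trans (hEp.of_generic hc h hg g1) (hE.symm (hEp.of_generic hc h hg g2))

theorem Generic.of_swap (hS : S.IsWellBehaved) {X Z W P Q T : Set M} (hZ : S.CardEq X Z)
    (hZ' : S.CardEq Xᶜ Zᶜ) (hPZ : P ⊆ Z) (hQT : Q ⊆ T) (hTZ : Disjoint T Z)
    (hP : S.CardEq X P) (hQ : S.CardEq X Q) (hle : S.CardLE X (Z \ P))
    (hT : S.CardEq T (T \ Q)) (hW : W = Z \ P ∪ Q) : S.Generic X Z W := by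
  have hc := hS.comprehension
  have hQZ : Disjoint Q Z := hTZ.mono_left hQT
  have hZC := (hZ.symm hc).left_isC hc
  have hQ' : ∀ x, x ∈ Q → x ∉ Z := fun x h => Set.disjoint_left.1 hQZ h
  have hT' : ∀ x, x ∈ T → x ∉ Z := fun x h => Set.disjoint_left.1 hTZ h
  have e1 : Z ∩ W = Z \ P := by
    subst hW
    ext x
    have := hQ' x
    simp only [Set.mem_sdiff, Set.mem_union, Set.mem_inter_iff]
    tauto
  have e2 : Z \ W = P := by
    subst hW
    ext x
    have := hQ' x
    have := @hPZ x
    simp only [Set.mem_sdiff, Set.mem_union]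
    tauto
  have e3 : W \ Z = Q := by
    subst hW
    ext x
    have := hQ' x
    simp only [Set.mem_sdiff, Set.mem_union]
    tauto
  have e4 : (Z ∪ W)ᶜ = Zᶜ \ T ∪ T \ Q := by
    subst hW
    ext x
    have := hT' x
    have := @hQT x
    simp only [Set.mem_sdiff, Set.mem_union, Set.mem_compl_iff]
    tauto
  refine ⟨?_, e2.symm ▸ hP, e3.symm ▸ hQ, ?_⟩
  · rw [e1]
    exact hS.antisymm hle ((CardLE.of_subset hc (hZC.diff hc ((hP.symm hc).left_isC hc))
      Set.sdiff_subset).trans hc (hZ.symm hc).le)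
  · rw [e4]
    have := (CardEq.refl hc ((hZC.compl hc).diff hc (hT.left_isC hc))).union hc hT
      Set.disjoint_sdiff_left (Set.disjoint_sdiff_left.mono_right Set.sdiff_subset)
    rw [Set.sdiff_union_of_subset hTZ.subset_compl_right] at this
    exact hZ'.trans hc this

theorem exists_generic (hS : S.IsWellBehaved) (hE : Equivalence E) (hEp : S.PermInvariant E)
    {X Y Z : S.Concept} (hX : S.DedekindInfinite X.carrier) (hY : S.Bicard X Y)
    (hZ : S.Bicard X Z) (h : E Y Z) (h1 : S.CardLE X.carrier (Y.carrier \ Z.carrier))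
    (h2 : S.CardLE X.carrier (Y.carrier ∩ Z.carrier) ∨
      S.CardLE X.carrier (Y.carrier ∪ Z.carrier)ᶜ) :
    ∃ U W : S.Concept, E U W ∧ S.Generic X.carrier U.carrier W.carrier := by
  have hc := hS.comprehension
  have hD := Y.isC.diff hc Z.isC
  -- In the first case the exchange takes place inside `Y`, so it fixes `Y` and alters `Z`; in the
  -- second it takes place outside `Z`, so it fixes `Z` and alters `Y`.
  rcases h2 with h2 | h2
  · obtain ⟨P, p1, p2, -, p4⟩ := hX.exists_part hS (Y.isC.inter hc Z.isC)
    obtain ⟨Q, q1, q2, -, q4⟩ := hX.exists_part hS hD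
    obtain ⟨p3, p4⟩ := p4 h2
    obtain ⟨q3, q4⟩ := q4 h1
    have hPZ : P ⊆ Z.carrier := p1.trans Set.inter_subset_right
    let W := ((Z.isC.diff hc p2).union hc q2).toConcept
    refine ⟨Z, W, hE.trans (hE.symm h) (hEp.of_swap hc h ((p3.symm hc).trans hc q3) hPZ
      (Set.disjoint_sdiff_left.mono_left q1) (.inl (Set.union_subset (p1.trans
        Set.inter_subset_left) (q1.trans Set.sdiff_subset))) (W := W) rfl),
      Generic.of_swap hS hZ.1 hZ.2 hPZ q1 Set.disjoint_sdiff_left p3 q3 ?_ q4 rfl⟩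
    exact (h2.trans hc p4.le).trans hc (.of_subset hc ((p4.symm hc).left_isC hc)
      (Set.sdiff_subset_sdiff_left Set.inter_subset_right))
  · obtain ⟨P, p1, p2, -, p4⟩ := hX.exists_part hS hD
    obtain ⟨Q, q1, q2, -, q4⟩ := hX.exists_part hS ((Y.isC.union hc Z.isC).compl hc)
    obtain ⟨p3, p4⟩ := p4 h1
    obtain ⟨q3, q4⟩ := q4 h2
    have hPY : P ⊆ Y.carrier := p1.trans Set.sdiff_subset
    have hdY : Disjoint (Y.carrier ∪ Z.carrier)ᶜ Y.carrier :=
      disjoint_compl_left.mono_right Set.subset_union_left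
    have hdZ : Disjoint (Y.carrier ∪ Z.carrier)ᶜ Z.carrier :=
      disjoint_compl_left.mono_right Set.subset_union_right
    let W := ((Y.isC.diff hc p2).union hc q2).toConcept
    refine ⟨Y, W, hE.trans h (hEp.of_swap hc (hE.symm h) ((p3.symm hc).trans hc q3) hPY
      (hdY.mono_left q1) (.inr (Set.disjoint_union_left.2
        ⟨Set.disjoint_sdiff_left.mono_left p1, hdZ.mono_left q1⟩)) (W := W) rfl),
      Generic.of_swap hS hY.1 hY.2 hPY q1 hdY p3 q3 ?_ q4 rfl⟩
    exact (h1.trans hc p4.le).trans hc (.of_subset hc ((p4.symm hc).left_isC hc)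
      (Set.sdiff_subset_sdiff_left Set.sdiff_subset))

/-! ### Slices of finite concepts -/

/-- For finite `X`, the size of an exchange determines all four cardinals. Only the exchanged sets
need be finite for cancellation, so the cell outside the union, which may be infinite, is also
covered. -/
theorem rel_of_swap_rel (hS : S.IsWellBehaved) (hEp : S.PermInvariant E) {X A W Y Z : S.Concept}
    (hX : S.DedekindFinite X.carrier) (hA : S.Bicard X A) (hY : S.Bicard X Y) (hZ : S.Bicard X Z)
    (h : E A W) {P Q : Set M} (hP : P ⊆ A.carrier) (hQ : Disjoint Q A.carrier)
    (hPD : S.CardEq (Y.carrier \ Z.carrier) P) (hQD : S.CardEq (Y.carrier \ Z.carrier) Q)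
    (hW : W.carrier = A.carrier \ P ∪ Q) : E Y Z := by
  have hc := hS.comprehension
  have hYZ := ((hY.symm hc).trans hc hZ).diff hS (hX.mono hc X.isC (hY.1.symm hc).le)
  have hAY := (hA.symm hc).trans hc hY
  have hAfin := hX.mono hc X.isC (hA.1.symm hc).le
  have hPfin := hAfin.subset hc A.isC ((hPD.symm hc).left_isC hc) hP
  have hQfin := hPfin.mono hc (hPD.symm hc |>.left_isC hc) ((hQD.symm hc).trans hc hPD).le
  have hQ' : ∀ x, x ∈ Q → x ∉ A.carrier := fun x h => Set.disjoint_left.1 hQ h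
  refine (hEp.iff_of_cardEq hc (Y := A) (Z := W) ?_ ?_ ?_ ?_).1 h
  · have := hAY.1.diff hS (hPD.symm hc) hP Set.sdiff_subset hPfin
    rw [Set.sdiff_sdiff_right_self] at this
    convert this using 1
    rw [hW]
    ext x
    have := hQ' x
    simp only [Set.mem_sdiff, Set.mem_union, Set.mem_inter_iff]
    tauto
  · convert hPD.symm hc using 1
    rw [hW]
    ext x
    have := hQ' x
    have := @hP x
    simp only [Set.mem_sdiff, Set.mem_union]
    tauto
  · convert (hQD.symm hc).trans hc hYZ using 1
    rw [hW]
    ext x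
    have := hQ' x
    simp only [Set.mem_sdiff, Set.mem_union]
    tauto
  · have := hAY.2.diff hS ((hQD.symm hc).trans hc hYZ) hQ.subset_compl_right
      (fun x hx => hx.2) hQfin
    convert this using 1
    · rw [hW]
      ext x
      have := hQ' x
      simp only [Set.mem_sdiff, Set.mem_union, Set.mem_compl_iff]
      tauto
    · ext x
      simp only [Set.mem_sdiff, Set.mem_union, Set.mem_compl_iff]
      tauto

/-- The finite analogue of `exists_generic`: one related pair with room for `m` in two suitable
cells makes every exchange of size at most `|m|` preserve `E`. -/
theorem small_swaps (hS : S.IsWellBehaved) (hE : Equivalence E) (hEp : S.PermInvariant E)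
    {X Y Z : S.Concept} (hX : S.DedekindFinite X.carrier) (hY : S.Bicard X Y)
    (hZ : S.Bicard X Z) (h : E Y Z) {m : Set M} (h1 : S.CardLE m (Y.carrier \ Z.carrier))
    (h2 : S.CardLE m (Y.carrier ∩ Z.carrier) ∨ S.CardLE m (Y.carrier ∪ Z.carrier)ᶜ)
    {Y' Z' : S.Concept} (hY' : S.Bicard X Y') (hZ' : S.Bicard X Z')
    (hm : S.CardLE (Y'.carrier \ Z'.carrier) m) : E Y' Z' := by
  have hc := hS.comprehension
  rcases h2 with h2 | h2
  · obtain ⟨P, p1, p2, p3⟩ := (hm.trans hc h2).exists_subset hc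
    obtain ⟨Q, q1, q2, q3⟩ := (hm.trans hc h1).exists_subset hc
    have hPZ : P ⊆ Z.carrier := p1.trans Set.inter_subset_right
    have hQZ : Disjoint Q Z.carrier := Set.disjoint_sdiff_left.mono_left q1
    let W := ((Z.isC.diff hc p2).union hc q2).toConcept
    exact rel_of_swap_rel hS hEp hX hZ hY' hZ' (hE.trans (hE.symm h) (hEp.of_swap hc h
      ((p3.symm hc).trans hc q3) hPZ hQZ (.inl (Set.union_subset (p1.trans
        Set.inter_subset_left) (q1.trans Set.sdiff_subset))) (W := W) rfl)) hPZ hQZ p3 q3 rfl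
  · obtain ⟨P, p1, p2, p3⟩ := (hm.trans hc h1).exists_subset hc
    obtain ⟨Q, q1, q2, q3⟩ := (hm.trans hc h2).exists_subset hc
    have hPY : P ⊆ Y.carrier := p1.trans Set.sdiff_subset
    have hdY : Disjoint Q Y.carrier :=
      (disjoint_compl_left.mono_right Set.subset_union_left).mono_left q1
    have hdZ : Disjoint Q Z.carrier :=
      (disjoint_compl_left.mono_right Set.subset_union_right).mono_left q1
    let W := ((Y.isC.diff hc p2).union hc q2).toConcept
    exact rel_of_swap_rel hS hEp hX hY hY' hZ' (hE.trans h (hEp.of_swap hc (hE.symm h)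
      ((p3.symm hc).trans hc q3) hPY hdY (.inr (Set.disjoint_union_left.2
        ⟨Set.disjoint_sdiff_left.mono_left p1, hdZ⟩)) (W := W) rfl)) hPY hdY p3 q3 rfl

/-! ### The trichotomy -/

theorem trivial_or_complementative (hS : S.IsWellBehaved) (hE : Equivalence E)
    (hEp : S.PermInvariant E) (X : S.Concept) : S.Trivial E X ∨ S.Complementative E X := by
  have hc := hS.comprehension
  by_contra hcon
  rw [not_or] at hcon
  obtain ⟨hnt, hncomp⟩ := hcon
  simp only [Complementative, not_forall, not_or] at hncomp
  obtain ⟨Y, hY, Z, hZ, h, n1, n2⟩ := hncomp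
  have hDC := Y.isC.symmDiff hc Z.isC
  have c1 := Cov.of_not_triLT hS X.isC hDC n1
  have c2 := Cov.of_not_triLT hS X.isC (hDC.compl hc) n2
  rw [symmDiff_compl_eq] at c2
  have i1 := Y.isC.diff hc Z.isC
  have i2 := Z.isC.diff hc Y.isC
  have i3 := Y.isC.inter hc Z.isC
  have i4 := (Y.isC.union hc Z.isC).compl hc
  refine hnt (Set.Subset.antisymm (fun V hV => hV.1) fun V hV => ⟨hV, ?_⟩)
  by_cases hX : S.DedekindInfinite X.carrier
  · have l1 := hX.le_union hS i1 i2 (c1.le_of_infinite hS hX X.isC)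
    have l2 := hX.le_union hS i3 i4 (c2.le_of_infinite hS hX X.isC)
    -- The large difference lies in the complement of a member of the class.
    have hle : S.CardLE X.carrier X.carrierᶜ := by
      rcases l1 with l | l
      · exact (l.trans hc (.of_subset hc i1 fun x hx => hx.2)).trans hc (hZ.2.symm hc).le
      · exact (l.trans hc (.of_subset hc i2 fun x hx => hx.2)).trans hc (hY.2.symm hc).le
    have hg : ∃ U W : S.Concept, E U W ∧ S.Generic X.carrier U.carrier W.carrier := by
      rcases l1 with l | l
      · exact exists_generic hS hE hEp hX hY hZ h l l2
      · rw [Set.inter_comm, Set.union_comm] at l2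
        exact exists_generic hS hE hEp hX hZ hY (hE.symm h) l l2
    obtain ⟨U, W, hUW, hg⟩ := hg
    exact rel_of_generic hS hE hEp hX hle hUW hg hV
  · have hX : S.DedekindFinite X.carrier := hX
    have hYZ := ((Bicard.symm hc hY).trans hc hZ).diff hS (hX.mono hc X.isC (hY.1.symm hc).le)
    have d1 : S.Cov X.carrier (Y.carrier \ Z.carrier) :=
      c1.trans hc ((Cov.of_le (CardEq.refl hc i1).le).union (.of_le (hYZ.symm hc).le))
    have d2 : S.Cov X.carrier (Y.carrier ∩ Z.carrier) ∨
        S.Cov X.carrier (Y.carrier ∪ Z.carrier)ᶜ := by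
      rcases hS.total i3 i4 with l | l
      · exact .inr (c2.trans hc ((Cov.of_le l).union (.of_le (CardEq.refl hc i4).le)))
      · exact .inl (c2.trans hc ((Cov.of_le (CardEq.refl hc i3).le).union (.of_le l)))
    -- The threshold `m` is the smaller of the two large cells, so it fits into both and still
    -- covers `X`.
    obtain ⟨m, hm, m1, m2⟩ : ∃ m, S.Cov X.carrier m ∧ S.CardLE m (Y.carrier \ Z.carrier) ∧
        (S.CardLE m (Y.carrier ∩ Z.carrier) ∨ S.CardLE m (Y.carrier ∪ Z.carrier)ᶜ) := by
      rcases d2 with d2 | d2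
      · rcases hS.total i1 i3 with l | l
        · exact ⟨_, d1, (CardEq.refl hc i1).le, .inl l⟩
        · exact ⟨_, d2, l, .inl (CardEq.refl hc i3).le⟩
      · rcases hS.total i1 i4 with l | l
        · exact ⟨_, d1, (CardEq.refl hc i1).le, .inr l⟩
        · exact ⟨_, d2, l, .inr (CardEq.refl hc i4).le⟩
    exact rel_of_small_swaps hS hE hX hm (fun Y' hY' Z' hZ' hle =>
      small_swaps hS hE hEp hX hY hZ h m1 m2 hY' hZ' hle) (Bicard.refl hc X) hV

/-- A finite concept related to a bicardinally equivalent one, other than itself and its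
complement, is related to all its neighbours. -/
theorem neighbours_rel (hS : S.IsWellBehaved) (hE : Equivalence E) (hEp : S.PermInvariant E)
    {X Y : S.Concept} (hX : S.DedekindFinite X.carrier) (hY : S.Bicard X Y) (h : E X Y)
    (hne : X.carrier ≠ Y.carrier) (hne' : Y.carrier ≠ X.carrierᶜ) (a : M) {Y' Z' : S.Concept}
    (hY' : S.Bicard X Y') (hZ' : S.Bicard X Z') (hle : S.CardLE (Y'.carrier \ Z'.carrier) {a}) :
    E Y' Z' := by
  have hc := hS.comprehension
  -- The threshold is one element: a nonempty difference, and a nonempty intersection or outside,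
  -- are enough.
  refine small_swaps hS hE hEp hX (.refl hc X) hY h (m := {a}) (CardLE.singleton hc a ?_) ?_
    hY' hZ' hle
  · rw [Set.nonempty_iff_ne_empty]
    intro h0
    have := hY.diff hS hX
    rw [h0] at this
    exact hne ((Set.sdiff_eq_empty.1 h0).antisymm (Set.sdiff_eq_empty.1 (this.symm hc).eq_empty))
  · by_cases h1 : (X.carrier ∩ Y.carrier).Nonempty
    · exact .inl (CardLE.singleton hc a h1)
    · refine .inr (CardLE.singleton hc a ?_)
      by_contra h2
      rw [Set.not_nonempty_iff_eq_empty] at h1 h2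
      refine hne' (Set.ext fun x => ?_)
      have e1 := Set.ext_iff.1 h1 x
      have e2 := Set.ext_iff.1 h2 x
      simp only [Set.mem_inter_iff, Set.mem_compl_iff, Set.mem_union, Set.mem_empty_iff_false]
        at e1 e2 ⊢
      tauto

/-- Reduces (c) to the claim that one related concept besides `X` and its complement makes the slice
trivial. -/
theorem sliceClass_cases (hc : S.Comprehension) (hE : Equivalence E) (X : S.Concept)
    (h : ∀ Y, S.Bicard X Y → E X Y → X.carrier ≠ Y.carrier → Y.carrier ≠ X.carrierᶜ →
      ∀ V, S.Bicard X V → E X V) :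
    S.sliceClass E X = S.bicardClass X ∨ S.sliceClass E X = {X} ∨
      Concept.carrier '' S.sliceClass E X = {X.carrier, (X.carrier)ᶜ} := by
  have hXX : X ∈ S.sliceClass E X := ⟨.refl hc X, hE.refl X⟩
  by_cases h1 : ∃ Y ∈ S.sliceClass E X, X.carrier ≠ Y.carrier ∧ Y.carrier ≠ X.carrierᶜ
  · obtain ⟨Y, hY, n1, n2⟩ := h1
    exact .inl (Set.Subset.antisymm (fun V hV => hV.1) fun V hV =>
      ⟨hV, h Y hY.1 hY.2 n1 n2 V hV⟩)
  · push Not at h1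
    by_cases h2 : ∃ Y ∈ S.sliceClass E X, X.carrier ≠ Y.carrier
    · obtain ⟨Y, hY, n1⟩ := h2
      refine .inr (.inr (Set.Subset.antisymm ?_ ?_))
      · rintro _ ⟨V, hV, rfl⟩
        by_cases e : X.carrier = V.carrier
        · exact .inl e.symm
        · exact .inr (h1 V hV e)
      · rintro _ (rfl | rfl)
        · exact ⟨X, hXX, rfl⟩
        · exact ⟨Y, hY, h1 Y hY n1⟩
    · push Not at h2
      refine .inr (.inl (Set.Subset.antisymm (fun V hV => ?_) ?_))
      · exact (Concept.ext_carrier (h2 V hV)).symm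
      · rintro _ rfl
        exact hXX

theorem sliceClass_of_finite (hS : S.IsWellBehaved) (hE : Equivalence E)
    (hEp : S.PermInvariant E) (X : S.Concept) (hX : X.carrier.Finite) :
    S.sliceClass E X = S.bicardClass X ∨ S.sliceClass E X = {X} ∨
      Concept.carrier '' S.sliceClass E X = {X.carrier, (X.carrier)ᶜ} := by
  have hc := hS.comprehension
  refine sliceClass_cases hc hE X fun Y hY h n1 n2 V hV => ?_
  obtain ⟨a⟩ := ‹Nonempty M›
  have hXf := DedekindFinite.of_finite (S := S) hX
  exact rel_of_small_swaps hS hE hXf (.of_finite hc hX (Set.singleton_nonempty a))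
    (fun Y' hY' Z' hZ' hle => neighbours_rel hS hE hEp hXf hY h n1 n2 a hY' hZ' hle)
    (.refl hc X) hV

end SOStructure

/-! ### Formulas for inclusion, cardinality and finiteness -/

namespace L0Formula

theorem finite_freeInd (φ : L0Formula) : φ.freeInd.Finite := by
  induction φ with
  | eq i j => exact (Set.finite_singleton j).insert i
  | app n j t => exact Set.finite_range t
  | neg φ ih => exact ih
  | imp φ ψ ih ih' => exact ih.union ih'
  | all i φ ih => exact ih.subset Set.sdiff_subset
  | allRel n j φ ih => exact ih

theorem finite_freeRel (φ : L0Formula) : φ.freeRel.Finite := by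
  induction φ with
  | eq i j => exact Set.finite_empty
  | app n j t => exact Set.finite_singleton _
  | neg φ ih => exact ih
  | imp φ ψ ih ih' => exact ih.union ih'
  | all i φ ih => exact ih
  | allRel n j φ ih => exact ih.subset Set.sdiff_subset

/-- Conjunction. -/
def and (φ ψ : L0Formula) : L0Formula := .neg (.imp φ (.neg ψ))

/-- Disjunction. -/
def or (φ ψ : L0Formula) : L0Formula := .imp (.neg φ) ψ

/-- Biconditional. -/
def iff (φ ψ : L0Formula) : L0Formula := and (.imp φ ψ) (.imp ψ φ)

/-- First-order existential quantification. -/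
def ex (i : ℕ) (φ : L0Formula) : L0Formula := .neg (.all i (.neg φ))

/-- Second-order existential quantification. -/
def exRel (n j : ℕ) (φ : L0Formula) : L0Formula := .neg (.allRel n j (.neg φ))

/-- `V_j (x_i)` -/
def mem (j i : ℕ) : L0Formula := .app 0 j fun _ => i

/-- `V_i ⊆ V_j` -/
def sub (i j : ℕ) : L0Formula := .all 0 (.imp (mem i 0) (mem j 0))

/-- `V_i = V_j \ V_k` -/
def diff (i j k : ℕ) : L0Formula := .all 0 (iff (mem i 0) (and (mem j 0) (.neg (mem k 0))))

/-- `|V_i| ≤ |V_j|` -/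
def cardLE (i j : ℕ) : L0Formula :=
  exRel 1 0 (and
    (.all 0 (.imp (mem i 0) (ex 1 (and (.app 1 0 ![0, 1])
      (and (mem j 1) (.all 2 (.imp (.app 1 0 ![0, 2]) (.eq 2 1))))))))
    (.all 0 (.all 1 (.all 2 (.imp (mem i 0) (.imp (mem i 1)
      (.imp (.app 1 0 ![0, 2]) (.imp (.app 1 0 ![1, 2]) (.eq 0 1)))))))))

/-- `|V_i| < ω` -/
def finite (i : ℕ) : L0Formula :=
  .neg (exRel 0 (i + 1) (and (and (sub (i + 1) i) (.neg (sub i (i + 1)))) (cardLE i (i + 1))))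

end L0Formula

namespace SOStructure

variable {M : Type u} {S : SOStructure M}

/-! ### Semantics of the defined connectives and relations -/

@[simp] theorem sat_and (σ : S.Assignment) (φ ψ : L0Formula) :
    S.Sat σ (φ.and ψ) ↔ S.Sat σ φ ∧ S.Sat σ ψ := by
  simp [L0Formula.and, Sat]

@[simp] theorem sat_or (σ : S.Assignment) (φ ψ : L0Formula) :
    S.Sat σ (φ.or ψ) ↔ S.Sat σ φ ∨ S.Sat σ ψ := by
  simp only [L0Formula.or, Sat]
  tauto

@[simp] theorem sat_iff (σ : S.Assignment) (φ ψ : L0Formula) :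
    S.Sat σ (φ.iff ψ) ↔ (S.Sat σ φ ↔ S.Sat σ ψ) := by
  simp only [L0Formula.iff, sat_and, Sat]
  tauto

@[simp] theorem sat_ex (σ : S.Assignment) (i : ℕ) (φ : L0Formula) :
    S.Sat σ (φ.ex i) ↔ ∃ a, S.Sat ⟨Function.update σ.ind i a, σ.rel⟩ φ := by
  simp [L0Formula.ex, Sat]

@[simp] theorem sat_exRel (σ : S.Assignment) (n j : ℕ) (φ : L0Formula) :
    S.Sat σ (φ.exRel n j) ↔ ∃ R : ↥(S.rel n),
      S.Sat ⟨σ.ind, Function.update σ.rel n (Function.update (σ.rel n) j R)⟩ φ := by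
  simp [L0Formula.exRel, Sat]

@[simp] theorem sat_mem (σ : S.Assignment) (j i : ℕ) :
    S.Sat σ (.mem j i) ↔ σ.ind i ∈ Concept.carrier (σ.rel 0 j) := Iff.rfl

@[simp] theorem sat_sub (σ : S.Assignment) (i j : ℕ) :
    S.Sat σ (.sub i j) ↔ Concept.carrier (σ.rel 0 i) ⊆ Concept.carrier (σ.rel 0 j) := by
  simp [L0Formula.sub, Sat, Set.subset_def]

@[simp] theorem sat_diff (σ : S.Assignment) (i j k : ℕ) :
    S.Sat σ (.diff i j k) ↔ Concept.carrier (σ.rel 0 i) =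
      Concept.carrier (σ.rel 0 j) \ Concept.carrier (σ.rel 0 k) := by
  simp [L0Formula.diff, Sat, Set.ext_iff]

/-- The form that a formula can express. The relation `R` may be arbitrary off `A`; comprehension
restricts it to the graph of an injection. -/
theorem cardLE_iff_exists_rel {A B : Set M} [Nonempty M] (hc : S.Comprehension) (hA : S.IsC A) :
    S.CardLE A B ↔ ∃ R ∈ S.rel 1,
      (∀ x ∈ A, ∃ y, ![x, y] ∈ R ∧ y ∈ B ∧ ∀ z, ![x, z] ∈ R → z = y) ∧
      ∀ x y z, x ∈ A → y ∈ A → ![x, z] ∈ R → ![y, z] ∈ R → x = y := by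
  constructor
  · rintro ⟨f, hf, hm, hi⟩
    refine ⟨_, hf, fun x hx => ⟨f x, ⟨hx, rfl⟩, hm hx, fun z hz => hz.2⟩, ?_⟩
    intro x y z hx hy hxz hyz
    have h1 : z = f x := hxz.2
    have h2 : z = f y := hyz.2
    exact hi hx hy (h1.symm.trans h2)
  · rintro ⟨R, hR, h1, h2⟩
    choose! f hf hfB hfu using h1
    refine ⟨f, ?_, hfB, fun x hx y hy h => h2 x y (f x) hx hy (hf x hx) (h ▸ hf y hy)⟩
    refine IsRel.congr (P := fun v : Fin 2 → M => v 0 ∈ A ∧ v ∈ R)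
      ((hA.mem hc (0 : Fin 2)).and hc hR) fun v => and_congr_right fun hv => ?_
    have e : v = ![v 0, v 1] := by
      ext i
      fin_cases i <;> rfl
    constructor
    · intro h
      rw [e] at h
      exact hfu _ hv _ h
    · intro h
      rw [e, h]
      exact hf _ hv

theorem sat_cardLE [Nonempty M] (hc : S.Comprehension) (σ : S.Assignment) (i j : ℕ) :
    S.Sat σ (.cardLE i j) ↔
      S.CardLE (Concept.carrier (σ.rel 0 i)) (Concept.carrier (σ.rel 0 j)) := by
  have e (s : ℕ → M) (a b : ℕ) : (fun k => s (![a, b] k)) = ![s a, s b] := by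
    ext k
    fin_cases k <;> rfl
  rw [cardLE_iff_exists_rel hc (Concept.isC _)]
  simp [L0Formula.cardLE, Sat, e]
  exact exists_congr fun R => and_left_comm

theorem sat_finite [Nonempty M] (hc : S.Comprehension) (σ : S.Assignment) (i : ℕ) :
    S.Sat σ (.finite i) ↔ S.DedekindFinite (Concept.carrier (σ.rel 0 i)) := by
  simp [L0Formula.finite, Sat, sat_cardLE hc, DedekindFinite, DedekindInfinite,
    ssubset_iff_subset_not_subset]

/-! ### Least cardinalities -/

section
variable [Nonempty M]

/-- Truth depends only on `V^1_0`, so quantifying universally over all other free variables changes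
nothing, the ranges being nonempty. This frees applications of well-foundedness from checking free
variables. -/
theorem exists_closed_formula {P : S.Concept → Prop} (φ : L0Formula)
    (hφ : ∀ σ : S.Assignment, S.Sat σ φ ↔ P (σ.rel 0 0)) :
    ∃ ψ : L0Formula, ψ.freeInd = ∅ ∧ ψ.freeRel ⊆ {(0, 0)} ∧
      ∀ σ : S.Assignment, S.Sat σ ψ ↔ P (σ.rel 0 0) := by
  have h1 (s : Set ℕ) (hs : s.Finite) : ∃ ψ : L0Formula, ψ.freeInd = φ.freeInd \ s ∧
      ∀ σ : S.Assignment, S.Sat σ ψ ↔ P (σ.rel 0 0) := by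
    induction s, hs using Set.Finite.induction_on with
    | empty => exact ⟨φ, by simp, hφ⟩
    | @insert a s _ _ ih =>
      obtain ⟨ψ, i1, i2⟩ := ih
      refine ⟨.all a ψ, ?_, fun σ => ?_⟩
      · rw [L0Formula.freeInd, i1, Set.sdiff_sdiff, Set.union_singleton]
      · simp [Sat, i2]
  obtain ⟨χ, c1, c2⟩ := h1 _ φ.finite_freeInd
  rw [Set.sdiff_self] at c1
  have h2 (s : Set (ℕ × ℕ)) (hs : s.Finite) (h0 : (0, 0) ∉ s) : ∃ ψ : L0Formula,
      ψ.freeInd = ∅ ∧ ψ.freeRel = χ.freeRel \ s ∧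
      ∀ σ : S.Assignment, S.Sat σ ψ ↔ P (σ.rel 0 0) := by
    induction s, hs using Set.Finite.induction_on with
    | empty => exact ⟨χ, c1, by simp, c2⟩
    | @insert a s _ _ ih =>
      obtain ⟨ψ, i1, i2, i3⟩ := ih fun h => h0 (.inr h)
      refine ⟨.allRel a.1 a.2 ψ, i1, ?_, fun σ => ?_⟩
      · rw [L0Formula.freeRel, i2, Set.sdiff_sdiff, Set.union_singleton]
      · have ha : a ≠ (0, 0) := fun h => h0 (.inl h.symm)
        have : Nonempty ↥(S.rel a.1) := (S.rel_nonempty a.1).to_subtype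
        have hu (R : ↥(S.rel a.1)) :
            Function.update σ.rel a.1 (Function.update (σ.rel a.1) a.2 R) 0 0 = σ.rel 0 0 := by
          obtain ⟨n, j⟩ := a
          rcases eq_or_ne n 0 with rfl | hn
          · rcases eq_or_ne j 0 with rfl | hj
            · exact absurd rfl ha
            · simp [Function.update_of_ne hj.symm]
          · rw [Function.update_of_ne hn.symm]
        simp [Sat, i3, hu]
  obtain ⟨ψ, d1, d2, d3⟩ := h2 (χ.freeRel \ {(0, 0)})
    (χ.finite_freeRel.subset Set.sdiff_subset) (fun h => h.2 rfl)
  refine ⟨ψ, d1, ?_, d3⟩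
  rw [d2, Set.sdiff_sdiff_right_self]
  exact Set.inter_subset_right

theorem IsWellBehaved.exists_least (hS : S.IsWellBehaved) {P : S.Concept → Prop} (φ : L0Formula)
    (hφ : ∀ σ : S.Assignment, S.Sat σ φ ↔ P (σ.rel 0 0)) (h : ∃ X, P X) :
    ∃ X, P X ∧ ∀ Y, P Y → S.CardLE X.carrier Y.carrier := by
  obtain ⟨ψ, h1, h2, h3⟩ := exists_closed_formula φ hφ
  have hex (X : S.Concept) : ∃ σ : S.Assignment, σ.rel 0 0 = X :=
    ⟨⟨S.base.ind, Function.update S.base.rel 0 fun _ => X⟩, by simp⟩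
  obtain ⟨X, hX⟩ := h
  obtain ⟨σ, rfl⟩ := hex X
  obtain ⟨τ, t1, t2⟩ := hS.wellFounded ψ h1 h2 ⟨σ, (h3 σ).2 hX⟩
  refine ⟨τ.rel 0 0, (h3 τ).1 t1, fun Y hY => ?_⟩
  obtain ⟨ρ, rfl⟩ := hex Y
  exact t2 ρ ((h3 ρ).2 hY)

/-! ### Halving finite concepts -/

/-- Up to the point `p`, `A` is the disjoint union of two equinumerous concepts. -/
def Halvable (S : SOStructure M) (A : Set M) : Prop :=
  ∃ U V : S.Concept, ∃ p : M, Disjoint U.carrier V.carrier ∧ U.carrier ⊆ A ∧ V.carrier ⊆ A ∧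
    S.CardLE U.carrier V.carrier ∧ S.CardLE V.carrier U.carrier ∧
    A ⊆ U.carrier ∪ V.carrier ∪ {p}

theorem DedekindFinite.halvable (hS : S.IsWellBehaved) {A : Set M} (hA : S.DedekindFinite A)
    (hAC : S.IsC A) : S.Halvable A := by
  have hc := hS.comprehension
  by_contra hcon
  obtain ⟨X, ⟨hXf, hX⟩, hmin⟩ := hS.exists_least
    (P := fun X => S.DedekindFinite X.carrier ∧ ¬ S.Halvable X.carrier)
    (.and (.finite 0) (.neg (.exRel 0 2 (.exRel 0 3 (.ex 0 (.and
      (.all 1 (.imp (.mem 2 1) (.neg (.mem 3 1)))) (.and (.sub 2 0) (.and (.sub 3 0) (.and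
        (.cardLE 2 3) (.and (.cardLE 3 2)
          (.all 1 (.imp (.mem 0 1) (.or (.eq 1 0) (.or (.mem 2 1) (.mem 3 1)))))))))))))))
    (fun σ => by
      simp [Sat, sat_finite hc, sat_cardLE hc, Halvable, Set.disjoint_left, Set.subset_def])
    ⟨hAC.toConcept, hA, hcon⟩
  have hne : X.carrier.Nonempty := by
    by_contra h0
    rw [Set.not_nonempty_iff_eq_empty] at h0
    obtain ⟨p⟩ := ‹Nonempty M›
    have := (CardEq.refl hc (IsC.empty (S := S) hc)).le
    exact hX ⟨(IsC.empty hc).toConcept, (IsC.empty hc).toConcept, p, by simp [h0, this]⟩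
  obtain ⟨p, hp⟩ := hne
  have hY := X.isC.diff hc (.singleton hc p)
  -- Removing a point from a finite concept lowers its cardinality, so minimality applies.
  have hYh : S.Halvable (X.carrier \ {p}) := by
    by_contra hn
    have := hXf.eq_of_subset hY Set.sdiff_subset (hmin hY.toConcept
      ⟨hXf.subset hc X.isC hY Set.sdiff_subset, hn⟩)
    exact (this.symm ▸ hp : p ∈ X.carrier \ {p}).2 rfl
  obtain ⟨U, V, q, hd, hU, hV, h1, h2, hsub⟩ := hYh
  have hUX := hU.trans Set.sdiff_subset
  have hVX := hV.trans Set.sdiff_subset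
  have hcov : X.carrier ⊆ U.carrier ∪ V.carrier ∪ {q} ∪ {p} := by
    rw [Set.union_comm]
    exact Set.sdiff_subset_iff.1 hsub
  -- If a point `q` is left over, `p` and `q` are added to different halves; otherwise `p` becomes
  -- the leftover point.
  by_cases hq : q ∈ X.carrier ∧ q ≠ p ∧ q ∉ U.carrier ∧ q ∉ V.carrier
  · obtain ⟨q1, q2, q3, q4⟩ := hq
    have p1 : p ∉ U.carrier := fun h => (hU h).2 rfl
    have p2 : p ∉ V.carrier := fun h => (hV h).2 rfl
    have e := (hS.antisymm h1 h2).union hc (CardEq.singleton hc p q)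
      (Set.disjoint_singleton_right.2 p1) (Set.disjoint_singleton_right.2 q4)
    refine hX ⟨(U.isC.union hc (.singleton hc p)).toConcept,
      (V.isC.union hc (.singleton hc q)).toConcept, p, ?_,
      Set.union_subset hUX (Set.singleton_subset_iff.2 hp),
      Set.union_subset hVX (Set.singleton_subset_iff.2 q1), e.le, (e.symm hc).le, ?_⟩
    · simp [hd, p2, q3, q2]
    · intro x hx
      rcases hcov hx with ((h | h) | h) | h
      · exact .inl (.inl (.inl h))
      · exact .inl (.inr (.inl h))
      · exact .inl (.inr (.inr h))
      · exact .inr h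
  · refine hX ⟨U, V, p, hd, hUX, hVX, h1, h2, fun x hx => ?_⟩
    rcases hcov hx with (h | rfl) | h
    · exact .inl h
    · by_contra h'
      exact hq ⟨hx, fun h => h' (.inr h), fun h => h' (.inl (.inl h)), fun h => h' (.inl (.inr h))⟩
    · exact .inr h

/-- A concept `X` with `|X| ⊴ |M - X|` has a bicardinal equivalent that is far from both `X` and
the complement of `X`. -/
theorem exists_far (hS : S.IsWellBehaved) (hM : 2 < ENat.card M) {X : S.Concept}
    (hX : S.Cov X.carrier X.carrierᶜ) :
    ∃ Y, S.Bicard X Y ∧ S.Cov X.carrier (symmDiff X.carrier Y.carrier) ∧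
      S.Cov X.carrier (symmDiff X.carrier Y.carrier)ᶜ := by
  have hc := hS.comprehension
  by_cases hUV : ∃ U V : Set M, S.IsC U ∧ S.IsC V ∧ Disjoint U V ∧ U ⊆ X.carrier ∧
      V ⊆ X.carrier ∧ S.Cov X.carrier U ∧ S.Cov X.carrier V
  · obtain ⟨U, V, hU, hV, hd, hUX, hVX, cU, cV⟩ := hUV
    have hX' := X.isC.compl hc
    -- `P` leaves `X` in exchange for `Q`. If the complement of `X` is too small to receive all of
    -- `U`, it is exchanged whole, and it still covers `X` by `hX`.
    obtain ⟨P, Q, hPU, hP, hQX, hQ, e, cP⟩ : ∃ P Q : Set M, P ⊆ U ∧ S.IsC P ∧ Q ⊆ X.carrierᶜ ∧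
        S.IsC Q ∧ S.CardEq P Q ∧ S.Cov X.carrier P := by
      rcases hS.total hU hX' with h | h
      · obtain ⟨Q, q1, q2, e⟩ := h.exists_subset hc
        exact ⟨U, Q, subset_rfl, hU, q1, q2, e, cU⟩
      · obtain ⟨P, p1, p2, e⟩ := h.exists_subset hc
        exact ⟨P, _, p1, p2, subset_rfl, hX', e.symm hc, hX.trans hc (.of_le e.le)⟩
    have hPX := hPU.trans hUX
    let Y := ((X.isC.diff hc hP).union hc hQ).toConcept
    have hsub1 : P ⊆ symmDiff X.carrier Y.carrier := fun x hx =>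
      .inl ⟨hPX hx, fun h => h.elim (fun h => h.2 hx) fun h => hQX h (hPX hx)⟩
    have hsub2 : V ⊆ (symmDiff X.carrier Y.carrier)ᶜ := by
      intro x hx h
      have hxP : x ∉ P := fun h => Set.disjoint_left.1 hd (hPU h) hx
      rcases h with h | h
      · exact h.2 (.inl ⟨hVX hx, hxP⟩)
      · exact h.2 (hVX hx)
    exact ⟨Y, .of_swap hc e hPX (Set.disjoint_left.2 hQX) rfl,
      cP.trans hc (.of_le (.of_subset hc hP hsub1)),
      cV.trans hc (.of_le (.of_subset hc hV hsub2))⟩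
  · have hXf : S.DedekindFinite X.carrier := by
      intro hinf
      obtain ⟨U, V, hd, hu, e1, e2⟩ := hinf.exists_halves hS X.isC
      exact hUV ⟨U, V, (e1.symm hc).left_isC hc, (e2.symm hc).left_isC hc, hd,
        hu ▸ Set.subset_union_left, hu ▸ Set.subset_union_right, .of_le e1.le, .of_le e2.le⟩
    obtain ⟨U, V, p, hd, hU, hV, h1, h2, hsub⟩ := hXf.halvable hS X.isC
    -- A nonempty half covers `X`, since it also absorbs the odd point. So both halves are empty and
    -- `X` has at most one element.
    have hU0 : ¬ U.carrier.Nonempty := by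
      intro hne
      have cU : S.Cov X.carrier U.carrier := Cov.subset
        (((Cov.of_le (CardEq.refl hc U.isC).le).union (.of_le h2)).union
          (.of_finite hc (Set.finite_singleton p) hne)) hsub
      exact hUV ⟨_, _, U.isC, V.isC, hd, hU, hV, cU, cU.trans hc (.of_le h1)⟩
    have hV0 : ¬ V.carrier.Nonempty := fun ⟨x, hx⟩ =>
      let ⟨f, _, hm, _⟩ := h2
      hU0 ⟨_, hm hx⟩
    rw [Set.not_nonempty_iff_eq_empty] at hU0 hV0
    rw [hU0, hV0, Set.union_empty, Set.empty_union] at hsub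
    rcases Set.subset_singleton_iff_eq.1 hsub with h0 | h0
    · have := Cov.of_le (CardEq.refl hc X.isC).le
      exact absurd ⟨_, _, X.isC, X.isC, by simp [h0], subset_rfl, subset_rfl, this, this⟩ hUV
    -- For `X = {p}`, moving to `{q}` leaves `r` as the witness that the complement of the
    -- difference is nonempty; this is the use of `|M| > 2`.
    · obtain ⟨q, r, hq, hr, hqr⟩ : ∃ q r : M, q ≠ p ∧ r ≠ p ∧ r ≠ q := by
        by_contra! hcon
        obtain ⟨q, hq⟩ : ∃ q : M, Set.univ ⊆ {p, q} := by
          by_cases h : ∃ q : M, q ≠ p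
          · obtain ⟨q, hq⟩ := h
            refine ⟨q, fun x _ => ?_⟩
            by_cases hx : x = p
            · exact .inl hx
            · exact .inr (hcon q x hq hx)
          · push Not at h
            exact ⟨p, fun x _ => .inl (h x)⟩
        rw [← Set.encard_univ] at hM
        refine absurd ((Set.encard_le_encard hq).trans (Set.encard_insert_le {q} p)) ?_
        rwa [Set.encard_singleton, one_add_one_eq_two, not_le]
      have hfin : X.carrier.Finite := h0 ▸ Set.finite_singleton p
      refine ⟨(IsC.singleton hc q).toConcept, .of_swap hc (CardEq.singleton hc p q) h0.ge
        (by simpa [h0] using hq) (by simp [h0]), .of_finite hc hfin ⟨p, ?_⟩,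
        .of_finite hc hfin ⟨r, ?_⟩⟩
      · simpa [h0, Set.mem_symmDiff] using hq.symm
      · simp [h0, hr, hqr]

/-! ### Definable equivalence relations -/

theorem HasFun.symm (hc : S.Comprehension) {π : Equiv.Perm M} (hπ : S.HasFun π Set.univ) :
    S.HasFun π.symm Set.univ :=
  (hπ.rel hc (1 : Fin 2) 0).congr fun v => by
    simp [Equiv.eq_symm_apply, eq_comm]

theorem mem_rel_of_perm (hc : S.Comprehension) {π : Equiv.Perm M} (hπ : S.HasFun π Set.univ)
    {n : ℕ} (R : ↥(S.rel n)) : {v : Fin (n + 1) → M | (fun i => π (v i)) ∈ R.1} ∈ S.rel n := by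
  classical
  suffices H : ∀ s : Finset (Fin (n + 1)),
      S.IsRel fun v : Fin (n + 1) → M => (fun i => if i ∈ s then π (v i) else v i) ∈ R.1 by
    have := H Finset.univ
    simp only [Finset.mem_univ, if_true] at this
    exact this
  -- The permutation is applied one coordinate at a time, because its graph is only a binary
  -- relation of the structure.
  intro s
  induction s using Finset.induction_on with
  | empty =>
    simp only [Finset.notMem_empty, if_false]
    exact R.2
  | insert a s ha ih =>
    have h1 := IsRel.reindex hc ih (fun i => if i = a then Fin.last (n + 1) else i.castSucc)
    refine (IsRel.ex hc (P := fun (v : Fin (n + 1) → M) y => (v a ∈ Set.univ ∧ y = π (v a)) ∧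
      (fun i => if i ∈ s then π (if i = a then y else v i) else if i = a then y else v i) ∈ R.1)
      ((hπ.rel hc a.castSucc (Fin.last _)).and hc (h1.congr fun w => ?_))).congr fun v => ?_
    · simp only [apply_ite w]
      rfl
    · simp only [Set.mem_univ, true_and, exists_eq_left]
      have : (fun i => if i ∈ s then π (if i = a then π (v a) else v i)
          else if i = a then π (v a) else v i) =
          fun i => if i ∈ insert a s then π (v i) else v i := by
        funext i
        rcases eq_or_ne i a with rfl | hi
        · simp [ha]
        · simp [hi]
      rw [this]

/-- The action of a permutation of the structure on its relations. -/
def permRel (hc : S.Comprehension) {π : Equiv.Perm M} (hπ : S.HasFun π Set.univ) (n : ℕ)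
    (R : ↥(S.rel n)) : ↥(S.rel n) :=
  ⟨_, mem_rel_of_perm hc (hπ.symm hc) R⟩

theorem permRel_surjective (hc : S.Comprehension) {π : Equiv.Perm M} (hπ : S.HasFun π Set.univ)
    (n : ℕ) : Function.Surjective (permRel hc hπ n) := by
  intro R
  refine ⟨⟨_, mem_rel_of_perm hc hπ R⟩, Subtype.ext ?_⟩
  ext v
  simp [permRel]

theorem carrier_permRel (hc : S.Comprehension) {π : Equiv.Perm M} (hπ : S.HasFun π Set.univ)
    (X : S.Concept) : Concept.carrier (permRel hc hπ 0 X) = π '' X.carrier := by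
  rw [Equiv.image_eq_preimage_symm]
  rfl

/-- Permutations of the structure preserve satisfaction. -/
theorem sat_perm_iff (hc : S.Comprehension) {π : Equiv.Perm M} (hπ : S.HasFun π Set.univ)
    (φ : L0Formula) (σ : S.Assignment) :
    S.Sat ⟨fun i => π (σ.ind i), fun n j => permRel hc hπ n (σ.rel n j)⟩ φ ↔ S.Sat σ φ := by
  induction φ generalizing σ with
  | eq i j => simp [Sat]
  | app n j t => simp [Sat, permRel]
  | neg φ ih => simp only [Sat, ih]
  | imp φ ψ ih ih' => simp only [Sat, ih, ih']
  | all i φ ih =>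
    simp only [Sat]
    rw [← π.forall_congr_right]
    refine forall_congr' fun a => ?_
    rw [← ih ⟨Function.update σ.ind i a, σ.rel⟩]
    have : (fun k => π (Function.update σ.ind i a k)) =
        Function.update (fun k => π (σ.ind k)) i (π a) := by
      funext k
      simp only [Function.update_apply, apply_ite π]
    simp only [this]
  | allRel n j φ ih =>
    simp only [Sat]
    refine (permRel_surjective hc hπ n).forall.trans (forall_congr' fun R => ?_)
    rw [← ih ⟨σ.ind, Function.update σ.rel n (Function.update (σ.rel n) j R)⟩]
    have : (fun m k => permRel hc hπ m (Function.update σ.rel n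
        (Function.update (σ.rel n) j R) m k)) =
        Function.update (fun m k => permRel hc hπ m (σ.rel m k)) n
          (Function.update (fun k => permRel hc hπ n (σ.rel n k)) j (permRel hc hπ n R)) := by
      funext m k
      rcases eq_or_ne m n with rfl | hm
      · simp only [Function.update_self, Function.update_apply, apply_ite (permRel hc hπ m)]
      · simp only [Function.update_of_ne hm]
    simp only [this]

theorem L0Definable.permInvariant (hc : S.Comprehension) {E : S.Concept → S.Concept → Prop}
    (hE : S.L0Definable E) : S.PermInvariant E := by
  obtain ⟨φ, -, -, hφ⟩ := hE
  intro π hπ X Y X' Y' hX hY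
  let σ : S.Assignment := ⟨S.base.ind, Function.update S.base.rel 0 fun j => if j = 0 then X else Y⟩
  have h := sat_perm_iff hc hπ φ σ
  rw [hφ, hφ] at h
  have e1 : σ.rel 0 0 = X := by simp [σ]
  have e2 : σ.rel 0 1 = Y := by simp [σ]
  simp only [e1, e2] at h
  rw [← h, Concept.ext_carrier (hX.trans (carrier_permRel hc hπ X).symm),
    Concept.ext_carrier (hY.trans (carrier_permRel hc hπ Y).symm)]

theorem sliceClass_of_definable (hS : S.IsWellBehaved) {E : S.Concept → S.Concept → Prop}
    (hE : Equivalence E) (hEd : S.L0Definable E) (X : S.Concept)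
    (hX : S.DedekindFinite X.carrier) :
    S.sliceClass E X = S.bicardClass X ∨ S.sliceClass E X = {X} ∨
      Concept.carrier '' S.sliceClass E X = {X.carrier, (X.carrier)ᶜ} := by
  have hc := hS.comprehension
  have hEp := hEd.permInvariant hc
  refine sliceClass_cases hc hE X fun Y hY h n1 n2 V hV => ?_
  by_contra hXV
  obtain ⟨φ, -, -, hφ⟩ := hEd
  -- Substitution of `V_i`, `V_j` for `V_0`, `V_1` in `φ` without renaming: the latter are bound and
  -- forced to be coextensive with the former. Hence indices must be at least 2.
  let ψ (i j : ℕ) : L0Formula := .allRel 0 0 (.allRel 0 1 (.imp (.and (.sub 0 i) (.sub i 0))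
    (.imp (.and (.sub 1 j) (.sub j 1)) φ)))
  have hψ (σ : S.Assignment) (i j : ℕ) (hi : 2 ≤ i) (hj : 2 ≤ j) :
      S.Sat σ (ψ i j) ↔ E (σ.rel 0 i) (σ.rel 0 j) := by
    have i0 : i ≠ 0 := by omega
    have i1 : i ≠ 1 := by omega
    have j0 : j ≠ 0 := by omega
    have j1 : j ≠ 1 := by omega
    simp only [ψ, Sat, sat_and, sat_sub, hφ, Function.update_self, Function.update_of_ne i0,
      Function.update_of_ne i1, Function.update_of_ne j0, Function.update_of_ne j1, ne_eq,
      zero_ne_one, not_false_eq_true, Function.update_of_ne]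
    constructor
    · exact fun h => h _ _ ⟨subset_rfl, subset_rfl⟩ ⟨subset_rfl, subset_rfl⟩
    · rintro h R R' ⟨h1, h2⟩ ⟨h3, h4⟩
      rwa [Concept.ext_carrier (h1.antisymm h2), Concept.ext_carrier (h3.antisymm h4)]
  let nb (Y : S.Concept) : Prop := ∀ U : S.Concept, ∀ p q : M, p ∈ Y.carrier → q ∉ Y.carrier →
    U.carrier = Y.carrier \ {p} ∪ {q} → E Y U
  -- A counterexample is measured by its difference `W = Y \ Z`. Only the neighbour property of `Y`
  -- is retained from `X`, so that the statement has no parameters.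
  let P (W : S.Concept) : Prop := ∃ Y Z W' : S.Concept, S.DedekindFinite W.carrier ∧
    W.carrier = Y.carrier \ Z.carrier ∧ W'.carrier = Z.carrier \ Y.carrier ∧
    S.CardLE W.carrier W'.carrier ∧ S.CardLE W'.carrier W.carrier ∧ nb Y ∧ ¬ E Y Z
  obtain ⟨W, ⟨Y, Z, W', w1, w2, w3, w4, w5, w6, w7⟩, hmin⟩ := hS.exists_least (P := P)
    (.exRel 0 2 (.exRel 0 3 (.exRel 0 4 (.and (.finite 0) (.and (.diff 0 2 3) (.and (.diff 4 3 2)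
      (.and (.cardLE 0 4) (.and (.cardLE 4 0) (.and
        (.allRel 0 5 (.all 0 (.all 1 (.imp (.mem 2 0) (.imp (.neg (.mem 2 1))
          (.imp (.all 2 (.iff (.mem 5 2) (.or (.eq 2 1) (.and (.mem 2 2) (.neg (.eq 2 0))))))
            (ψ 2 5)))))))
        (.neg (ψ 2 3)))))))))))
    (fun σ => by
      simp [Sat, sat_finite hc, sat_cardLE hc, hψ, P, nb, Set.ext_iff]) (by
      have i1 := X.isC.diff hc V.isC
      have e := Bicard.diff hS hV hX
      refine ⟨i1.toConcept, X, V, (V.isC.diff hc X.isC).toConcept,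
        hX.subset hc X.isC i1 Set.sdiff_subset, rfl, rfl, e.le, (e.symm hc).le, ?_, hXV⟩
      intro U p q hp hq hU
      refine neighbours_rel hS hE hEp hX hY h n1 n2 p (.refl hc X)
        (.of_swap hc (CardEq.singleton hc p q) (Set.singleton_subset_iff.2 hp)
          (Set.disjoint_singleton_left.2 hq) hU) (.of_subset hc (X.isC.diff hc U.isC) ?_)
      rw [hU]
      rintro x ⟨h1, h2⟩
      by_contra h3
      exact h2 (.inl ⟨h1, h3⟩))
  have e := hS.antisymm w4 w5
  have hne : W.carrier.Nonempty := by
    by_contra h0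
    rw [Set.not_nonempty_iff_eq_empty] at h0
    rw [h0] at e
    have h0' := (e.symm hc).eq_empty
    rw [w2, Set.sdiff_eq_empty] at h0
    rw [w3, Set.sdiff_eq_empty] at h0'
    exact w7 (Concept.ext_carrier (h0.antisymm h0') ▸ hE.refl Y)
  obtain ⟨p, hp⟩ := hne
  obtain ⟨q, hq⟩ : W'.carrier.Nonempty :=
    let ⟨f, _, hm, _⟩ := w4
    ⟨f p, hm hp⟩
  have hpY : p ∈ Y.carrier ∧ p ∉ Z.carrier := by rwa [w2] at hp
  have hqZ : q ∈ Z.carrier ∧ q ∉ Y.carrier := by rwa [w3] at hq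
  have hpq : p ≠ q := fun h => hqZ.2 (h ▸ hpY.1)
  -- One step from `Y` towards `Z`: the difference loses the point `p`, contradicting minimality
  -- once `Y₁` is known to have the neighbour property.
  let Y₁ := ((Y.isC.diff hc (.singleton hc p)).union hc (.singleton hc q)).toConcept
  have hY₁ : E Y Y₁ := w6 Y₁ p q hpY.1 hqZ.2 rfl
  have hW₁ := W.isC.diff hc (.singleton hc p)
  have e₁ : S.CardEq (W.carrier \ {p}) (W'.carrier \ {q}) :=
    e.diff hS (CardEq.singleton hc p q) (Set.singleton_subset_iff.2 hp)
      (Set.singleton_subset_iff.2 hq) (.of_finite (Set.finite_singleton p))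
  have hle := hmin hW₁.toConcept ⟨Y₁, Z, (W'.isC.diff hc (.singleton hc q)).toConcept,
    w1.subset hc W.isC hW₁ Set.sdiff_subset, by
      simp only [IsC.carrier_toConcept, w2, Y₁]
      ext x
      simp only [Set.mem_sdiff, Set.mem_union, Set.mem_singleton_iff]
      grind, by
      simp only [IsC.carrier_toConcept, w3, Y₁]
      ext x
      simp only [Set.mem_sdiff, Set.mem_union, Set.mem_singleton_iff]
      grind, e₁.le, (e₁.symm hc).le, ?_, fun h => w7 (hE.trans hY₁ h)⟩
  · have := w1.eq_of_subset hW₁ Set.sdiff_subset hle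
    exact (this.symm ▸ hp : p ∈ W.carrier \ {p}).2 rfl
  -- The transposition of `p` and `q` carries `Y` to `Y₁`, so invariance carries over the neighbour
  -- property.
  · intro U p' q' hp' hq' hU
    obtain ⟨π, hπ, h1, -, h3⟩ := exists_swap hc (CardEq.singleton hc p q)
      (Set.disjoint_singleton.2 hpq)
    have hπY : π '' Y.carrier = Y₁.carrier := image_of_swap h1 h3
      (Set.singleton_subset_iff.2 hpY.1) (Set.disjoint_singleton_left.2 hqZ.2)
    let U₀ := ((Y.isC.diff hc (.singleton hc (π.symm p'))).union hc
      (.singleton hc (π.symm q'))).toConcept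
    have hU₀ : U.carrier = π '' U₀.carrier := by
      simp only [U₀, IsC.carrier_toConcept]
      rw [Set.image_union, Set.image_sdiff π.injective, Set.image_singleton, Set.image_singleton,
        Equiv.apply_symm_apply, Equiv.apply_symm_apply, hπY, hU]
    refine (hEp π hπ Y U₀ Y₁ U hπY.symm hU₀).1 (w6 U₀ (π.symm p') (π.symm q') ?_ ?_ rfl)
    · rw [← hπY] at hp'
      obtain ⟨x, hx, rfl⟩ := hp'
      simpa using hx
    · intro hx
      exact hq' (hπY ▸ ⟨_, hx, by simp⟩)

end

end SOStructure

/-! ### The theorem -/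

theorem mainTheorem1 {M : Type u} [Nonempty M] (S : SOStructure M) (hS : S.IsWellBehaved)
    (E : S.Concept → S.Concept → Prop) (hE : Equivalence E) :
    ((S.L0Definable E ∨ S.PermInvariant E) → ∀ X : S.Concept,
      (S.Trivial E X ∨ S.Separative E X ∨ S.Complementative E X) ∧
      (2 < ENat.card M →
        ExactlyOneOfThree (S.Trivial E X) (S.ProperlySeparative E X)
          (S.ProperlyComplementative E X) ∧
        (S.TriLE X.carrier (X.carrier)ᶜ →
          ExactlyOneOfThree (S.Trivial E X) (S.Separative E X)
            (S.Complementative E X ∧ ¬ S.Separative E X)))) ∧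
    (∀ X : S.Concept,
      (S.L0Definable E ∧ S.DedekindFinite X.carrier) ∨
        (S.PermInvariant E ∧ X.carrier.Finite) →
      S.sliceClass E X = S.bicardClass X ∨
      S.sliceClass E X = {X} ∨
      SOStructure.Concept.carrier '' S.sliceClass E X = {X.carrier, (X.carrier)ᶜ}) := by
  have hc := hS.comprehension
  refine ⟨fun h X => ?_, fun X h => ?_⟩
  · have hEp : S.PermInvariant E := h.elim (fun h => h.permInvariant hc) id
    have hmain := SOStructure.trivial_or_complementative hS hE hEp X
    have hsc : S.Separative E X → S.Complementative E X :=
      fun h Y hY Z hZ hYZ => .inl (h Y hY Z hZ hYZ)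
    refine ⟨by tauto, fun hM => ⟨?_, fun hle => ?_⟩⟩
    · unfold ExactlyOneOfThree SOStructure.ProperlySeparative SOStructure.ProperlyComplementative
      tauto
    -- A trivial slice relates `X` to a concept far from it and from its complement.
    · have htc : S.Trivial E X → ¬ S.Complementative E X := by
        intro ht hcomp
        obtain ⟨Y, hY, c1, c2⟩ := SOStructure.exists_far hS hM
          ((SOStructure.triLE_iff_cov hc X.isC).1 hle)
        have hXY : Y ∈ S.sliceClass E X := ht.symm.subset hY
        exact (hcomp X (.refl hc X) Y hY hXY.2).elim (c1.not_triLT hc X.isC)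
          (c2.not_triLT hc X.isC)
      unfold ExactlyOneOfThree
      tauto
  · rcases h with ⟨h, hX⟩ | ⟨h, hX⟩
    · exact SOStructure.sliceClass_of_definable hS hE h X hX
    · exact SOStructure.sliceClass_of_finite hS hE h X hX
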